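/- Let $F$ be a field (for instance $\mathbb R$ or $\mathbb C$) and let $m,n,p,r$ be nonnegative integers with $mnp>1$. Write $MM(m,n,p)$ for the multiplication of an $m\times n$ matrix $U=(u_{ij})$ by an $n\times p$ matrix $V=(v_{jk})$, and $MM(K)$ for $MM(K,K,K)$. Below, $O(\lambda)$ denotes a multiple of $\lambda$ in the polynomial ring $F[\lambda]$. Suppose that we are given a bilinear or a trilinear APA (any precision approximation) algorithm of border rank $r$ for $MM(m,n,p)$, that is, suppose that one of the following holds: (bilinear) there are linear forms $l_q(U)=\sum_{i,j}\alpha^{(q)}_{ij}u_{ij}$ and $l'_q(V)=\sum_{j,k}\beta^{(q)}_{jk}v_{jk}$ and coefficients $\gamma^{(q)}_{ik}$, $q=1,\dots,r$, with all $\alpha^{(q)}_{ij},\beta^{(q)}_{jk},\gamma^{(q)}_{ik}\in F[\lambda,\lambda^{-1}]$, such that $$\sum_{q=1}^r\gamma^{(q)}_{ik}\,l_q(U)\,l'_q(V)=\sum_{j=1}^n u_{ij}v_{jk}+O(\lambda)\qquad\text{for all } i,k;$$ (trilinear) there are linear forms $l_q(U)$, $l'_q(V)$, $l''_q(W)$,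 $q=1,\dots,r$, with coefficients in $F[\lambda,\lambda^{-1}]$, where $W$ is a $p\times m$ matrix, such that $$\sum_{q=1}^r l_q(U)\,l'_q(V)\,l''_q(W)=\operatorname{trace}(UVW)+O(\lambda).$$ Then there is a constant $\bar c$ such that for every integer $K\ge 0$ one can perform $MM(K)$ by using at most $\bar c\,K^{\omega}$ arithmetic operations, where $\omega=3\log_{mnp}(r)$. That is, for every $K$ there is a straight-line program over $F$, consisting of at most $\bar c\,K^\omega$ additions, subtractions and multiplications (operations with constants from $F$ included), that outputs the entries of $UV$ for all $K\times K$ matrices $U,V$ with entries in any commutative $F$-algebra. The constant $\bar c$ does not depend on $K$. -/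

import Mathlib

namespace FastMM

/-! ### Arithmetic algorithms: straight-line programs over a field, with a count of operations -/

/-- The arithmetic operations of a program. (Divisions are not needed; a program without them is in
particular an arithmetic program in the usual sense.) -/
inductive ArithOp where
  | add
  | sub
  | mul

/-- An operand of an instruction: a constant of `F`, one of the inputs (indexed by `ι`), or the
result of the instruction number `t` (counted from `0`). -/
inductive Operand (F : Type*) (ι : Type*) where
  | const (a : F)
  | input (i : ι)
  | result (t : ℕ)

/-- One instruction: a single arithmetic operation on two operands. -/
structure Instr (F : Type*) (ι : Type*) where
  op : ArithOp
  left : Operand F ι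
  right : Operand F ι

/-- A straight-line program with inputs indexed by `ι` and outputs indexed by `κ`. -/
structure Program (F : Type*) (ι : Type*) (κ : Type*) where
  code : List (Instr F ι)
  out : κ → Operand F ι

section Semantics

variable {F ι κ A : Type*} [Field F] [CommRing A] [Algebra F A]

/-- The effect of an operation. -/
def ArithOp.eval : ArithOp → A → A → A
  | .add, a, b => a + b
  | .sub, a, b => a - b
  | .mul, a, b => a * b

/-- The value of an operand for the input `x`, when `mem` lists the results computed so far in their
order. (A reference to a result that has not been computed yet reads the constant `0`.) -/
def Operand.eval (x : ι → A) (mem : List A) : Operand F ι → A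
  | .const a => algebraMap F A a
  | .input i => x i
  | .result t => mem.getD t 0

/-- Executes a list of instructions; each of them appends one result to the memory. -/
def run (x : ι → A) : List (Instr F ι) → List A → List A
  | [], mem => mem
  | I :: code, mem => run x code (mem ++ [I.op.eval (I.left.eval x mem) (I.right.eval x mem)])

/-- The outputs of a program on the input `x`. -/
def Program.eval (P : Program F ι κ) (x : ι → A) (k : κ) : A :=
  (P.out k).eval x (run x P.code [])

end Semantics

/-- The number of arithmetic operations performed by a program. Additions, subtractions and
multiplications all count, including those with constants. -/
def Program.cost {F ι κ : Type*} (P : Program F ι κ) : ℕ := P.code.length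

/-- `P` performs `MM(K)`: it reads the entries of two `K × K` matrices `U` and `V` (left and right
summand of the index type) and outputs the entries of `U * V`. The entries are arbitrary elements of
an arbitrary commutative `F`-algebra, e.g. of `F` itself or indeterminates over `F`. -/
def PerformsMM.{u} {F : Type u} [Field F] (K : ℕ)
    (P : Program F ((Fin K × Fin K) ⊕ (Fin K × Fin K)) (Fin K × Fin K)) : Prop :=
  ∀ (A : Type u) [CommRing A] [Algebra F A] (U V : Matrix (Fin K) (Fin K) A) (i k : Fin K),
    P.eval (Sum.elim (fun a => U a.1 a.2) (fun b => V b.1 b.2)) (i, k) = (U * V) i k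

/-! ### APA algorithms -/

section APA

variable {F : Type*} [Field F]

/-- `f = O(λ)`: the Laurent polynomial `f` in `λ` is `λ` times a polynomial in `λ`. -/
def IsOLambda (f : LaurentPolynomial F) : Prop :=
  ∃ e : Polynomial F, f = Polynomial.toLaurent (Polynomial.X * e)

/-- The linear form `∑ i j, a i j * u i j` with coefficients depending on `λ`, in the entries of a
matrix `u` over `F`. -/
noncomputable def linForm {m n : ℕ} (a : Matrix (Fin m) (Fin n) (LaurentPolynomial F))
    (u : Matrix (Fin m) (Fin n) F) : LaurentPolynomial F :=
  ∑ i, ∑ j, a i j * LaurentPolynomial.C (u i j)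

/-- The coefficients `α`, `β`, `γ` define a bilinear APA algorithm with `r` terms for `MM(m,n,p)`:
`∑ q, γ_{ik}^{(q)} l_q(U) l'_q(V) = ∑ j, u_{ij} v_{jk} + O(λ)`, as bilinear forms in `U` and `V`. -/
def IsBilinearAPA (m n p r : ℕ)
    (α : Fin r → Matrix (Fin m) (Fin n) (LaurentPolynomial F))
    (β : Fin r → Matrix (Fin n) (Fin p) (LaurentPolynomial F))
    (γ : Fin r → Matrix (Fin m) (Fin p) (LaurentPolynomial F)) : Prop :=
  ∀ (U : Matrix (Fin m) (Fin n) F) (V : Matrix (Fin n) (Fin p) F) (i : Fin m) (k : Fin p),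
    IsOLambda (∑ q, γ q i k * (linForm (α q) U * linForm (β q) V)
      - LaurentPolynomial.C ((U * V) i k))

/-- The coefficients `α`, `β`, `γ` define a trilinear APA algorithm with `r` terms for `MM(m,n,p)`:
`∑ q, l_q(U) l'_q(V) l''_q(W) = trace(UVW) + O(λ)`, as trilinear forms in `U`, `V` and `W`. -/
def IsTrilinearAPA (m n p r : ℕ)
    (α : Fin r → Matrix (Fin m) (Fin n) (LaurentPolynomial F))
    (β : Fin r → Matrix (Fin n) (Fin p) (LaurentPolynomial F))
    (γ : Fin r → Matrix (Fin p) (Fin m) (LaurentPolynomial F)) : Prop :=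
  ∀ (U : Matrix (Fin m) (Fin n) F) (V : Matrix (Fin n) (Fin p) F) (W : Matrix (Fin p) (Fin m) F),
    IsOLambda (∑ q, linForm (α q) U * linForm (β q) V * linForm (γ q) W
      - LaurentPolynomial.C (Matrix.trace (U * V * W)))

end APA

end FastMM

/-!
A bound `r` for the border rank of `⟨m, n, p⟩`, the tensor of the product of an `m × n` and an
`n × p` matrix, gives the exponent `ω = 3 * log r / log (m * n * p)` without loss of an `ε`, because
such a bound is never optimal: `r` is strictly larger than the number that the exponent of matrix
multiplication allows.

Tensors are considered up to mutual restriction (`TensClass`). With direct sum and Kronecker product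
they form an ordered commutative semiring, in which `n : ℕ` is the unit tensor with `n` terms, so
that `x ≤ n` says that the rank of `x` is at most `n`. An APA algorithm is a degeneration of the
unit tensor `r` to `⟨m, n, p⟩` (`IsBilinearAPA.deg`, `IsTrilinearAPA.deg`). The product of the three
rotations of `⟨m, n, p⟩` is `T = ⟨V, V, V⟩` with `V = m * n * p`, a degeneration of `r ^ 3`
(`TensClass.deg_matMul_cube`).

* The border rank of `T` is larger than `V ^ 2`, since otherwise all matrices would commute
  (`Tens.Deg.lt_of_matMul`). Hence for large `h` there is much room between `(r ^ 3) ^ h` and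
  `V ^ (2 * h)`.
* This room is used for an additional inner product: a perturbation of the algorithm with
  `r ^ (3 * h)` terms shows that `T ^ h ⊕ ⟨1, V ^ (2 * h + 1), 1⟩` is a degeneration of
  `(r ^ 3) ^ h ⊕ ⟨1, V ^ (2 * h), 1⟩` (`Tens.Deg.add_dot`).
* The asymptotic rank `asympRank`, the growth rate of the rank of powers, is monotone under
  degeneration (`Deg.asympRank_le`). It is bounded from below on sums by Schönhage's argument
  (`add_le_asympRank_add`). If the asymptotic rank of `T` were equal to `r ^ 3`, comparison of the
  two sides of the last degeneration, multiplied by a power of `T`, would show that the longer of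
  the two inner products is no harder than the shorter one, a contradiction
  (`TensClass.exists_pow_le_natCast_lt`).
* Hence some power `⟨M, M, M⟩` of `T` has an exact algorithm with fewer than `M ^ ω` multiplications
  (`TensClass.exists_matMul_le_natCast_lt`). As `M ^ 2 ≤ M ^ ω` as well, its recursive application
  takes `O(K ^ ω)` operations: the linear work of each level is absorbed by the gap
  (`exists_computesMul_le`).

Operations are counted first for sets of polynomials that are reachable from the variables (`Reach`,
`Computes`); `ComputesMul.exists_program` then turns such a computation into a program.
-/

namespace FastMM

open Polynomial

/-! ### Tensors and restriction -/

section Pull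

variable {L : Type*} [CommRing L]
  {A A' A'' B B' B'' C C' C'' : Type*}

/-- The tensor obtained from `t` by substituting, for each of the three groups of variables, the
linear forms with coefficient matrices `α`, `β` and `γ`. -/
def pull [Fintype A'] [Fintype B'] [Fintype C'] (α : A → A' → L) (β : B → B' → L) (γ : C → C' → L)
    (t : A' → B' → C' → L) (a : A) (b : B) (c : C) : L :=
  ∑ p : A' × B' × C', α a p.1 * β b p.2.1 * γ c p.2.2 * t p.1 p.2.1 p.2.2

/-- The direct sum of two tensors. -/
def directSum {A₁ A₂ B₁ B₂ C₁ C₂ : Type*} (t₁ : A₁ → B₁ → C₁ → L) (t₂ : A₂ → B₂ → C₂ → L) :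
    A₁ ⊕ A₂ → B₁ ⊕ B₂ → C₁ ⊕ C₂ → L
  | .inl a, .inl b, .inl c => t₁ a b c
  | .inr a, .inr b, .inr c => t₂ a b c
  | _, _, _ => 0

variable [Fintype A'] [Fintype B'] [Fintype C'] [Fintype A''] [Fintype B''] [Fintype C'']

theorem sum_triple_mul (f : A' → L) (g : B' → L) (h : C' → L) :
    ∑ p : A' × B' × C', f p.1 * g p.2.1 * h p.2.2 = (∑ a, f a) * (∑ b, g b) * ∑ c, h c := by
  simp only [Fintype.sum_prod_type, ← Finset.mul_sum, ← Finset.sum_mul]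

theorem pull_pull (α : A → A' → L) (β : B → B' → L) (γ : C → C' → L)
    (α' : A' → A'' → L) (β' : B' → B'' → L) (γ' : C' → C'' → L) (t : A'' → B'' → C'' → L) :
    pull α β γ (pull α' β' γ' t) =
      pull (fun a x => ∑ a', α a a' * α' a' x) (fun b x => ∑ b', β b b' * β' b' x)
        (fun c x => ∑ c', γ c c' * γ' c' x) t := by
  funext a b c
  simp only [pull]
  conv_lhs => simp only [Finset.mul_sum]
  rw [Finset.sum_comm]
  refine Finset.sum_congr rfl fun q _ => ?_
  rw [← sum_triple_mul (fun a' => α a a' * α' a' q.1) (fun b' => β b b' * β' b' q.2.1)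
    (fun c' => γ c c' * γ' c' q.2.2), Finset.sum_mul]
  exact Finset.sum_congr rfl fun p _ => by ring

theorem pull_prod {A₁ A₂ B₁ B₂ C₁ C₂ A₁' A₂' B₁' B₂' C₁' C₂' : Type*}
    [Fintype A₁'] [Fintype A₂'] [Fintype B₁'] [Fintype B₂'] [Fintype C₁'] [Fintype C₂']
    (α₁ : A₁ → A₁' → L) (β₁ : B₁ → B₁' → L) (γ₁ : C₁ → C₁' → L) (t₁ : A₁' → B₁' → C₁' → L)
    (α₂ : A₂ → A₂' → L) (β₂ : B₂ → B₂' → L) (γ₂ : C₂ → C₂' → L) (t₂ : A₂' → B₂' → C₂' → L)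
    (a : A₁ × A₂) (b : B₁ × B₂) (c : C₁ × C₂) :
    pull (fun (x : A₁ × A₂) (y : A₁' × A₂') => α₁ x.1 y.1 * α₂ x.2 y.2)
      (fun (x : B₁ × B₂) (y : B₁' × B₂') => β₁ x.1 y.1 * β₂ x.2 y.2)
      (fun (x : C₁ × C₂) (y : C₁' × C₂') => γ₁ x.1 y.1 * γ₂ x.2 y.2)
      (fun x y z => t₁ x.1 y.1 z.1 * t₂ x.2 y.2 z.2) a b c =
    pull α₁ β₁ γ₁ t₁ a.1 b.1 c.1 * pull α₂ β₂ γ₂ t₂ a.2 b.2 c.2 := by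
  simp only [pull]
  rw [Finset.sum_mul_sum, ← Fintype.sum_prod_type']
  refine Fintype.sum_equiv
    ⟨fun p => ((p.1.1, p.2.1.1, p.2.2.1), (p.1.2, p.2.1.2, p.2.2.2)),
     fun p => ((p.1.1, p.2.1), (p.1.2.1, p.2.2.1), (p.1.2.2, p.2.2.2)),
     fun _ => rfl, fun _ => rfl⟩ _ _ fun p => ?_
  simp only [Equiv.coe_fn_mk]
  ring

theorem pull_fromBlocks {A₁ A₂ B₁ B₂ C₁ C₂ A₁' A₂' B₁' B₂' C₁' C₂' : Type*}
    [Fintype A₁'] [Fintype A₂'] [Fintype B₁'] [Fintype B₂'] [Fintype C₁'] [Fintype C₂']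
    (α₁ : A₁ → A₁' → L) (β₁ : B₁ → B₁' → L) (γ₁ : C₁ → C₁' → L) (t₁ : A₁' → B₁' → C₁' → L)
    (α₂ : A₂ → A₂' → L) (β₂ : B₂ → B₂' → L) (γ₂ : C₂ → C₂' → L) (t₂ : A₂' → B₂' → C₂' → L) :
    pull (Matrix.fromBlocks α₁ 0 0 α₂) (Matrix.fromBlocks β₁ 0 0 β₂) (Matrix.fromBlocks γ₁ 0 0 γ₂)
      (directSum t₁ t₂) = directSum (pull α₁ β₁ γ₁ t₁) (pull α₂ β₂ γ₂ t₂) := by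
  funext a b c
  rcases a with a | a <;> rcases b with b | b <;> rcases c with c | c <;>
    simp [pull, directSum, Fintype.sum_prod_type, Matrix.fromBlocks]

theorem pull_ite [DecidableEq A'] [DecidableEq B'] [DecidableEq C'] (f : A → A') (g : B → B')
    (h : C → C') (t : A' → B' → C' → L) (a : A) (b : B) (c : C) :
    pull (fun a a' => if a' = f a then 1 else 0) (fun b b' => if b' = g b then 1 else 0)
      (fun c c' => if c' = h c then 1 else 0) t a b c = t (f a) (g b) (h c) := by
  simp [pull, Fintype.sum_prod_type]

end Pull

/-- A tensor of order three over `F`, in coordinates: a trilinear form in three finite groups of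
variables. -/
structure Tens (F : Type*) where
  A : Type
  B : Type
  C : Type
  [fintypeA : Fintype A]
  [fintypeB : Fintype B]
  [fintypeC : Fintype C]
  t : A → B → C → F

namespace Tens

attribute [instance] fintypeA fintypeB fintypeC

variable {F : Type*} [Field F]

/-- `S` is a restriction of `S'`: it arises from `S'` by a linear substitution of the variables. -/
def Restr (S S' : Tens F) : Prop :=
  ∃ (α : S.A → S'.A → F) (β : S.B → S'.B → F) (γ : S.C → S'.C → F), S.t = pull α β γ S'.t

theorem Restr.of_maps {S S' : Tens F} (f : S.A → S'.A) (g : S.B → S'.B) (h : S.C → S'.C)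
    (H : ∀ a b c, S.t a b c = S'.t (f a) (g b) (h c)) : Restr S S' := by
  classical
  exact ⟨_, _, _, funext fun a => funext fun b => funext fun c =>
    (H a b c).trans (pull_ite f g h S'.t a b c).symm⟩

theorem Restr.refl (S : Tens F) : Restr S S := .of_maps id id id fun _ _ _ => rfl

theorem Restr.trans {S S' S'' : Tens F} (h : Restr S S') (h' : Restr S' S'') : Restr S S'' := by
  obtain ⟨α, β, γ, h⟩ := h
  obtain ⟨α', β', γ', h'⟩ := h'
  exact ⟨_, _, _, by rw [h, h', pull_pull]⟩

instance : Preorder (Tens F) where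
  le := Restr
  le_refl := Restr.refl
  le_trans _ _ _ := Restr.trans

theorem le_of_maps {S S' : Tens F} (f : S.A → S'.A) (g : S.B → S'.B) (h : S.C → S'.C)
    (H : ∀ a b c, S.t a b c = S'.t (f a) (g b) (h c)) : S ≤ S' := Restr.of_maps f g h H

theorem equiv_of_equivs {S S' : Tens F} (f : S.A ≃ S'.A) (g : S.B ≃ S'.B) (h : S.C ≃ S'.C)
    (H : ∀ a b c, S.t a b c = S'.t (f a) (g b) (h c)) : AntisymmRel (· ≤ ·) S S' :=
  ⟨le_of_maps f g h H, le_of_maps f.symm g.symm h.symm fun a b c => by simp [H]⟩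

/-- The unit tensor `∑ i, x i * y i * z i`. -/
abbrev unit (F : Type*) [Field F] (n : ℕ) : Tens F where
  A := Fin n
  B := Fin n
  C := Fin n
  t a b c := if a = b ∧ b = c then 1 else 0

/-- The direct sum of tensors: independent sets of variables. -/
abbrev add (S S' : Tens F) : Tens F where
  A := S.A ⊕ S'.A
  B := S.B ⊕ S'.B
  C := S.C ⊕ S'.C
  t := directSum S.t S'.t

/-- The Kronecker product of tensors. -/
abbrev mul (S S' : Tens F) : Tens F where
  A := S.A × S'.A
  B := S.B × S'.B
  C := S.C × S'.C
  t a b c := S.t a.1 b.1 c.1 * S'.t a.2 b.2 c.2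

theorem add_mono {S₁ S₁' S₂ S₂' : Tens F} (h₁ : S₁ ≤ S₁') (h₂ : S₂ ≤ S₂') :
    add S₁ S₂ ≤ add S₁' S₂' := by
  obtain ⟨α, β, γ, h⟩ := h₁
  obtain ⟨α', β', γ', h'⟩ := h₂
  exact ⟨_, _, _, (congrArg₂ directSum h h').trans
    (pull_fromBlocks α β γ S₁'.t α' β' γ' S₂'.t).symm⟩

theorem mul_mono {S₁ S₁' S₂ S₂' : Tens F} (h₁ : S₁ ≤ S₁') (h₂ : S₂ ≤ S₂') :
    mul S₁ S₂ ≤ mul S₁' S₂' := by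
  obtain ⟨α, β, γ, h⟩ := h₁
  obtain ⟨α', β', γ', h'⟩ := h₂
  exact ⟨_, _, _, funext fun a => funext fun b => funext fun c =>
    (congrArg₂ (· * ·) (congrFun₃ h a.1 b.1 c.1) (congrFun₃ h' a.2 b.2 c.2)).trans
      (pull_prod α β γ S₁'.t α' β' γ' S₂'.t a b c).symm⟩

end Tens

/-- Tensors up to mutual restriction. With direct sum, Kronecker product and restriction they form
an ordered semiring, in which the number `n` is the unit tensor with `n` terms. -/
abbrev TensClass (F : Type*) [Field F] := Antisymmetrization (Tens F) (· ≤ ·)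

namespace TensClass

variable {F : Type*} [Field F]

/-- The class of a tensor. -/
def mk (S : Tens F) : TensClass F := toAntisymmetrization (· ≤ ·) S

theorem mk_le_mk {S S' : Tens F} : mk S ≤ mk S' ↔ S ≤ S' := Iff.rfl

theorem mk_eq_of_equivs {S S' : Tens F} (f : S.A ≃ S'.A) (g : S.B ≃ S'.B) (h : S.C ≃ S'.C)
    (H : ∀ a b c, S.t a b c = S'.t (f a) (g b) (h c)) : mk S = mk S' :=
  Quotient.sound (Tens.equiv_of_equivs f g h H)

theorem exists_mk (x : TensClass F) : ∃ S, mk S = x := Quotient.exists_rep x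

instance : Add (TensClass F) :=
  ⟨Quotient.map₂ Tens.add fun _ _ h _ _ h' => ⟨Tens.add_mono h.1 h'.1, Tens.add_mono h.2 h'.2⟩⟩

instance : Mul (TensClass F) :=
  ⟨Quotient.map₂ Tens.mul fun _ _ h _ _ h' => ⟨Tens.mul_mono h.1 h'.1, Tens.mul_mono h.2 h'.2⟩⟩

instance : NatCast (TensClass F) := ⟨fun n => mk (Tens.unit F n)⟩

theorem mk_add (S S' : Tens F) : mk S + mk S' = mk (Tens.add S S') := rfl

instance : Zero (TensClass F) := ⟨((0 : ℕ) : TensClass F)⟩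

instance : One (TensClass F) := ⟨((1 : ℕ) : TensClass F)⟩

protected theorem add_comm (x y : TensClass F) : x + y = y + x := by
  obtain ⟨S, rfl⟩ := exists_mk x
  obtain ⟨S', rfl⟩ := exists_mk y
  refine mk_eq_of_equivs (Equiv.sumComm _ _) (Equiv.sumComm _ _) (Equiv.sumComm _ _) ?_
  rintro (a | a) (b | b) (c | c) <;> rfl

protected theorem add_assoc (x y z : TensClass F) : x + y + z = x + (y + z) := by
  obtain ⟨S, rfl⟩ := exists_mk x
  obtain ⟨S', rfl⟩ := exists_mk y
  obtain ⟨S'', rfl⟩ := exists_mk z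
  refine mk_eq_of_equivs (Equiv.sumAssoc _ _ _) (Equiv.sumAssoc _ _ _) (Equiv.sumAssoc _ _ _) ?_
  rintro ((a | a) | a) ((b | b) | b) ((c | c) | c) <;> rfl

protected theorem zero_add (x : TensClass F) : 0 + x = x := by
  obtain ⟨S, rfl⟩ := exists_mk x
  refine mk_eq_of_equivs (Equiv.emptySum (Fin 0) _) (Equiv.emptySum (Fin 0) _)
    (Equiv.emptySum (Fin 0) _) ?_
  rintro (a | a) (b | b) (c | c)
  all_goals first | exact a.elim0 | exact b.elim0 | exact c.elim0 | rfl

protected theorem mul_comm (x y : TensClass F) : x * y = y * x := by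
  obtain ⟨S, rfl⟩ := exists_mk x
  obtain ⟨S', rfl⟩ := exists_mk y
  exact mk_eq_of_equivs (Equiv.prodComm _ _) (Equiv.prodComm _ _) (Equiv.prodComm _ _)
    fun _ _ _ => mul_comm _ _

protected theorem mul_assoc (x y z : TensClass F) : x * y * z = x * (y * z) := by
  obtain ⟨S, rfl⟩ := exists_mk x
  obtain ⟨S', rfl⟩ := exists_mk y
  obtain ⟨S'', rfl⟩ := exists_mk z
  exact mk_eq_of_equivs (Equiv.prodAssoc _ _ _) (Equiv.prodAssoc _ _ _) (Equiv.prodAssoc _ _ _)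
    fun _ _ _ => mul_assoc _ _ _

protected theorem one_mul (x : TensClass F) : 1 * x = x := by
  obtain ⟨S, rfl⟩ := exists_mk x
  refine mk_eq_of_equivs (Equiv.uniqueProd _ (Fin 1)) (Equiv.uniqueProd _ (Fin 1))
    (Equiv.uniqueProd _ (Fin 1)) fun a b c => ?_
  obtain ⟨a₁, a⟩ := a
  obtain ⟨b₁, b⟩ := b
  obtain ⟨c₁, c⟩ := c
  have h : a₁ = b₁ ∧ b₁ = c₁ := ⟨Subsingleton.elim (α := Fin 1) _ _,
    Subsingleton.elim (α := Fin 1) _ _⟩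
  exact (congrArg (· * S.t a b c) (if_pos h)).trans (one_mul _)

protected theorem zero_mul (x : TensClass F) : 0 * x = 0 := by
  obtain ⟨S, rfl⟩ := exists_mk x
  exact mk_eq_of_equivs (Equiv.equivOfIsEmpty (Fin 0 × _) (Fin 0))
    (Equiv.equivOfIsEmpty (Fin 0 × _) (Fin 0)) (Equiv.equivOfIsEmpty (Fin 0 × _) (Fin 0))
    fun a _ _ => a.1.elim0

protected theorem add_mul (x y z : TensClass F) : (x + y) * z = x * z + y * z := by
  obtain ⟨S, rfl⟩ := exists_mk x
  obtain ⟨S', rfl⟩ := exists_mk y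
  obtain ⟨S'', rfl⟩ := exists_mk z
  refine mk_eq_of_equivs (Equiv.sumProdDistrib _ _ _) (Equiv.sumProdDistrib _ _ _)
    (Equiv.sumProdDistrib _ _ _) ?_
  rintro ⟨a | a, a'⟩ ⟨b | b, b'⟩ ⟨c | c, c'⟩ <;>
    first | rfl | exact zero_mul _

protected theorem natCast_succ (n : ℕ) : ((n + 1 : ℕ) : TensClass F) = n + 1 := by
  refine (mk_eq_of_equivs (S := Tens.add (Tens.unit F n) (Tens.unit F 1))
    (S' := Tens.unit F (n + 1)) finSumFinEquiv finSumFinEquiv finSumFinEquiv ?_).symm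
  have key : ∀ a b c : Fin n ⊕ Fin 1, directSum (Tens.unit F n).t (Tens.unit F 1).t a b c =
      if finSumFinEquiv a = finSumFinEquiv b ∧ finSumFinEquiv b = finSumFinEquiv c
        then 1 else 0 := by
    simp only [finSumFinEquiv.apply_eq_iff_eq]
    rintro (a | a) (b | b) (c | c) <;> simp [directSum]
  exact key

instance : CommSemiring (TensClass F) where
  add_assoc := TensClass.add_assoc
  zero_add := TensClass.zero_add
  add_zero x := by rw [TensClass.add_comm, TensClass.zero_add]
  add_comm := TensClass.add_comm
  nsmul := nsmulRec
  mul_assoc := TensClass.mul_assoc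
  one_mul := TensClass.one_mul
  mul_one x := by rw [TensClass.mul_comm, TensClass.one_mul]
  mul_comm := TensClass.mul_comm
  zero_mul := TensClass.zero_mul
  mul_zero x := by rw [TensClass.mul_comm, TensClass.zero_mul]
  left_distrib x y z := by
    rw [TensClass.mul_comm, TensClass.add_mul, TensClass.mul_comm y, TensClass.mul_comm z]
  right_distrib := TensClass.add_mul
  natCast_zero := rfl
  natCast_succ := TensClass.natCast_succ

protected theorem zero_le (x : TensClass F) : 0 ≤ x := by
  obtain ⟨S, rfl⟩ := exists_mk x
  exact mk_le_mk.2 (Tens.le_of_maps (fun a : Fin 0 => a.elim0) (fun a : Fin 0 => a.elim0)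
    (fun a : Fin 0 => a.elim0) fun a => a.elim0)

instance : IsOrderedRing (TensClass F) where
  add_le_add_left x y h z := by
    obtain ⟨S, rfl⟩ := exists_mk x
    obtain ⟨S', rfl⟩ := exists_mk y
    obtain ⟨S'', rfl⟩ := exists_mk z
    exact Tens.add_mono (S₁ := S) (S₁' := S') (S₂ := S'') (S₂' := S'') h le_rfl
  zero_le_one := TensClass.zero_le _
  mul_le_mul_of_nonneg_left x _ y z h := by
    obtain ⟨S, rfl⟩ := exists_mk x
    obtain ⟨S', rfl⟩ := exists_mk y
    obtain ⟨S'', rfl⟩ := exists_mk z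
    exact Tens.mul_mono (S₁ := S) (S₁' := S) (S₂ := S') (S₂' := S'') le_rfl h
  mul_le_mul_of_nonneg_right x _ y z h := by
    obtain ⟨S, rfl⟩ := exists_mk x
    obtain ⟨S', rfl⟩ := exists_mk y
    obtain ⟨S'', rfl⟩ := exists_mk z
    exact Tens.mul_mono (S₁ := S') (S₁' := S'') (S₂ := S) (S₂' := S) h le_rfl

end TensClass

/-! ### Matrix multiplication tensors -/

namespace Tens

variable {F : Type*} [Field F]

/-- The tensor `trace (U * V * W)` of the multiplication of an `m × n` by an `n × p` matrix. -/
abbrev matMul (F : Type*) [Field F] (m n p : ℕ) : Tens F where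
  A := Fin m × Fin n
  B := Fin n × Fin p
  C := Fin p × Fin m
  t a b c := if a.2 = b.1 ∧ b.2 = c.1 ∧ c.2 = a.1 then 1 else 0

end Tens

theorem pull_diag_mul {L ι A A' B B' C C' : Type*} [CommRing L] [Fintype ι] [DecidableEq ι]
    [Fintype A'] [Fintype B'] [Fintype C'] (α : A → ι × A' → L) (β : B → ι × B' → L)
    (γ : C → ι × C' → L) (t : A' → B' → C' → L) (a : A) (b : B) (c : C) :
    pull α β γ (fun x y z => (if x.1 = y.1 ∧ y.1 = z.1 then 1 else 0) * t x.2 y.2 z.2) a b c =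
      ∑ i, pull (fun a x => α a (i, x)) (fun b x => β b (i, x)) (fun c x => γ c (i, x))
        t a b c := by
  simp only [pull, Fintype.sum_prod_type, ite_and, ite_mul, one_mul, zero_mul, mul_ite, mul_zero,
    Finset.sum_ite_irrel, Finset.sum_const_zero, Finset.sum_ite_eq, Finset.mem_univ, if_true]

theorem pull_diag {L ι A B C : Type*} [CommRing L] [Fintype ι] [DecidableEq ι]
    (α : A → ι → L) (β : B → ι → L) (γ : C → ι → L) (a : A) (b : B) (c : C) :
    pull α β γ (fun x y z => if x = y ∧ y = z then 1 else 0) a b c =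
      ∑ i, α a i * β b i * γ c i := by
  simp only [pull, Fintype.sum_prod_type, ite_and, mul_ite, mul_zero, mul_one,
    Finset.sum_ite_irrel, Finset.sum_const_zero, Finset.sum_ite_eq, Finset.mem_univ, if_true]

namespace TensClass

variable {F : Type*} [Field F]

theorem mk_le_natCast {S : Tens F} {n : ℕ} : mk S ≤ (n : TensClass F) ↔
    ∃ (α : S.A → Fin n → F) (β : S.B → Fin n → F) (γ : S.C → Fin n → F),
      ∀ a b c, S.t a b c = ∑ i, α a i * β b i * γ c i :=
  exists_congr fun α => exists_congr fun β => exists_congr fun γ =>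
    ⟨fun h a b c => (congrFun₃ h a b c).trans (pull_diag (L := F) (ι := Fin n) α β γ a b c),
     fun h => funext fun a => funext fun b => funext fun c =>
      (h a b c).trans (pull_diag (L := F) (ι := Fin n) α β γ a b c).symm⟩

theorem matMul_rotate (m n p : ℕ) (x : Fin m × Fin n) (y : Fin n × Fin p) (z : Fin p × Fin m) :
    (Tens.matMul F n p m).t y z x = (Tens.matMul F m n p).t x y z :=
  if_congr ⟨fun h => ⟨h.2.2, h.1, h.2.1⟩, fun h => ⟨h.2.1, h.2.2, h.1⟩⟩ rfl rfl

/-- The class of the tensor of the multiplication of an `m × n` by an `n × p` matrix. -/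
def matMul (F : Type*) [Field F] (m n p : ℕ) : TensClass F := mk (Tens.matMul F m n p)

/-- The Kronecker product of two matrix multiplications is a matrix multiplication: this is block
matrix multiplication. -/
theorem matMul_mul (m n p m' n' p' : ℕ) :
    matMul F m n p * matMul F m' n' p' = matMul F (m * m') (n * n') (p * p') := by
  let e (i j k l : ℕ) : (Fin i × Fin j) × (Fin k × Fin l) ≃ Fin (i * k) × Fin (j * l) :=
    (Equiv.prodProdProdComm _ _ _ _).trans (finProdFinEquiv.prodCongr finProdFinEquiv)
  refine mk_eq_of_equivs (S := Tens.mul (Tens.matMul F m n p) (Tens.matMul F m' n' p'))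
    (e m n m' n') (e n p n' p') (e p m p' m') ?_
  have key : ∀ (a : (Fin m × Fin n) × (Fin m' × Fin n')) (b : (Fin n × Fin p) × (Fin n' × Fin p'))
      (c : (Fin p × Fin m) × (Fin p' × Fin m')),
      (Tens.mul (Tens.matMul F m n p) (Tens.matMul F m' n' p')).t a b c =
        if (e m n m' n' a).2 = (e n p n' p' b).1 ∧ (e n p n' p' b).2 = (e p m p' m' c).1 ∧
          (e p m p' m' c).2 = (e m n m' n' a).1 then 1 else 0 := by
    rintro ⟨⟨a₁, a₂⟩, a₃, a₄⟩ ⟨⟨b₁, b₂⟩, b₃, b₄⟩ ⟨⟨c₁, c₂⟩, c₃, c₄⟩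
    simp only [e, Equiv.trans_apply, Equiv.prodProdProdComm_apply,
      Equiv.prodCongr_apply, Prod.map, finProdFinEquiv.apply_eq_iff_eq, Prod.mk.injEq,
      ← ite_and, mul_ite, mul_one, mul_zero]
    exact if_congr (by tauto) rfl rfl
  exact key

theorem matMul_one : matMul F 1 1 1 = 1 := by
  refine mk_eq_of_equivs (S := Tens.matMul F 1 1 1) (S' := Tens.unit F 1)
    (Equiv.uniqueProd _ _) (Equiv.uniqueProd _ _) (Equiv.uniqueProd _ _) ?_
  have key : ∀ (a b c : Fin 1 × Fin 1),
      (if a.2 = b.1 ∧ b.2 = c.1 ∧ c.2 = a.1 then (1 : F) else 0) =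
        if Equiv.uniqueProd (Fin 1) (Fin 1) a = Equiv.uniqueProd (Fin 1) (Fin 1) b ∧
          Equiv.uniqueProd (Fin 1) (Fin 1) b = Equiv.uniqueProd (Fin 1) (Fin 1) c
        then 1 else 0 := fun a b c => by
    rw [if_pos ⟨Subsingleton.elim _ _, Subsingleton.elim _ _, Subsingleton.elim _ _⟩,
      if_pos ⟨Subsingleton.elim _ _, Subsingleton.elim _ _⟩]
  exact key

theorem matMul_pow (m n p k : ℕ) : matMul F m n p ^ k = matMul F (m ^ k) (n ^ k) (p ^ k) := by
  induction k with
  | zero => simp [matMul_one]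
  | succ k ih => rw [pow_succ, ih, matMul_mul, pow_succ, pow_succ, pow_succ]

theorem matMul_rotate_le {m n p r : ℕ} (h : matMul F m n p ≤ (r : TensClass F)) :
    matMul F n p m ≤ (r : TensClass F) := by
  obtain ⟨α, β, γ, h⟩ := mk_le_natCast.1 h
  exact (mk_le_natCast (S := Tens.matMul F n p m)).2 ⟨β, γ, α,
    fun b c a => (matMul_rotate m n p a b c).trans
      ((h a b c).trans (Finset.sum_congr rfl fun i _ => by ring))⟩

/-- Every tensor has finite rank. -/
theorem exists_le_natCast (x : TensClass F) : ∃ n : ℕ, x ≤ n := by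
  classical
  obtain ⟨S, rfl⟩ := exists_mk x
  let e := Fintype.equivFin (S.A × S.B × S.C)
  refine ⟨Fintype.card (S.A × S.B × S.C), mk_le_natCast.2 ⟨
    fun a i => if a = (e.symm i).1 then 1 else 0, fun b i => if b = (e.symm i).2.1 then 1 else 0,
    fun c i => if c = (e.symm i).2.2 then S.t (e.symm i).1 (e.symm i).2.1 c else 0,
    fun a b c => ?_⟩⟩
  rw [Equiv.sum_comp e.symm (fun p : S.A × S.B × S.C => (if a = p.1 then 1 else 0) *
    (if b = p.2.1 then 1 else 0) * (if c = p.2.2 then S.t p.1 p.2.1 c else 0))]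
  simp [Fintype.sum_prod_type]

end TensClass

/-! ### Degenerations -/

/-- `S` is a degeneration of `S'`, with exponent `d`: a linear substitution with coefficients in
`F[X]` turns `S'` into `X ^ d * (S + O(X))`. -/
def Tens.Deg {F : Type*} [Field F] (d : ℕ) (S S' : Tens F) : Prop :=
  ∃ (α : S.A → S'.A → F[X]) (β : S.B → S'.B → F[X]) (γ : S.C → S'.C → F[X])
    (e : S.A → S.B → S.C → F[X]), ∀ a b c,
      pull α β γ (fun x y z => Polynomial.C (S'.t x y z)) a b c =
        X ^ d * (Polynomial.C (S.t a b c) + X * e a b c)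

namespace Tens

variable {F : Type*} [Field F]

theorem Deg.mul {d d' : ℕ} {S₁ S₁' S₂ S₂' : Tens F} (h : Deg d S₁ S₁') (h' : Deg d' S₂ S₂') :
    Deg (d + d') (Tens.mul S₁ S₂) (Tens.mul S₁' S₂') := by
  obtain ⟨α, β, γ, e, h⟩ := h
  obtain ⟨α', β', γ', e', h'⟩ := h'
  refine ⟨fun x y => α x.1 y.1 * α' x.2 y.2, fun x y => β x.1 y.1 * β' x.2 y.2,
    fun x y => γ x.1 y.1 * γ' x.2 y.2, fun a b c =>
      Polynomial.C (S₁.t a.1 b.1 c.1) * e' a.2 b.2 c.2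
        + e a.1 b.1 c.1 * Polynomial.C (S₂.t a.2 b.2 c.2)
        + X * (e a.1 b.1 c.1 * e' a.2 b.2 c.2), fun a b c => ?_⟩
  have key := pull_prod α β γ (fun x y z => Polynomial.C (S₁'.t x y z)) α' β' γ'
    (fun x y z => Polynomial.C (S₂'.t x y z)) a b c
  rw [h, h'] at key
  simp only [Tens.mul, Polynomial.C_mul]
  refine key.trans ?_
  ring

theorem Deg.refl (S : Tens F) : Deg 0 S S := by
  classical
  exact ⟨_, _, _, 0, fun a b c => (pull_ite id id id _ a b c).trans (by simp)⟩

theorem Deg.trans_le {d : ℕ} {S S' S'' : Tens F} (h : Deg d S S') (h' : S' ≤ S'') :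
    Deg d S S'' := by
  obtain ⟨α, β, γ, e, h⟩ := h
  obtain ⟨α', β', γ', h'⟩ := h'
  have key : (fun x y z => Polynomial.C (S'.t x y z)) =
      pull (fun x y => Polynomial.C (α' x y)) (fun x y => Polynomial.C (β' x y))
        (fun x y => Polynomial.C (γ' x y)) (fun x y z => Polynomial.C (S''.t x y z)) := by
    rw [h']
    funext x y z
    simp [pull]
  rw [key] at h
  simp only [pull_pull] at h
  exact ⟨_, _, _, e, h⟩

theorem Deg.le_trans {d : ℕ} {S S' S'' : Tens F} (h : S ≤ S')
    (h' : Deg d S' S'') : Deg d S S'' := by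
  obtain ⟨α, β, γ, h⟩ := h
  obtain ⟨α', β', γ', e, h'⟩ := h'
  have key (a b c) : pull (fun x y => Polynomial.C (α x y)) (fun x y => Polynomial.C (β x y))
      (fun x y => Polynomial.C (γ x y))
      (pull α' β' γ' fun x y z => Polynomial.C (S''.t x y z)) a b c =
        Polynomial.X ^ d * (Polynomial.C (S.t a b c) + Polynomial.X *
          pull (fun x y => Polynomial.C (α x y)) (fun x y => Polynomial.C (β x y))
            (fun x y => Polynomial.C (γ x y)) e a b c) := by
    rw [h]
    simp only [pull, map_sum, map_mul, Finset.mul_sum, ← Finset.sum_add_distrib]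
    refine Finset.sum_congr rfl fun p _ => ?_
    have := h' p.1 p.2.1 p.2.2
    simp only [pull] at this
    rw [← Finset.mul_sum, this]
    ring
  simp only [pull_pull] at key
  exact ⟨_, _, _, _, key⟩

theorem coeff_mul_mul (f g h : F[X]) (d : ℕ) :
    (f * g * h).coeff d = ∑ s : Fin (d + 1), ∑ t : Fin (d + 1),
      f.coeff s * g.coeff t * (if (s : ℕ) + t ≤ d then h.coeff (d - s - t) else 0) := by
  rw [mul_assoc, Polynomial.coeff_mul, Finset.Nat.sum_antidiagonal_eq_sum_range_succ_mk,
    Finset.sum_range]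
  refine Finset.sum_congr rfl fun s _ => ?_
  rw [Polynomial.coeff_mul, Finset.Nat.sum_antidiagonal_eq_sum_range_succ_mk, Finset.mul_sum,
    Fin.sum_univ_eq_sum_range
      (fun t => f.coeff s * g.coeff t * (if (s : ℕ) + t ≤ d then h.coeff (d - s - t) else 0))]
  have hs : (d - s).succ ≤ d + 1 := by omega
  rw [← Finset.sum_subset (Finset.range_subset_range.2 hs)]
  · refine Finset.sum_congr rfl fun t ht => ?_
    rw [Finset.mem_range] at ht
    rw [if_pos (by omega)]
    ring
  · intro t _ ht
    rw [Finset.mem_range] at ht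
    rw [if_neg (by omega), mul_zero]

/-- A degeneration becomes a restriction after extracting the coefficient of `X ^ d`, at the price
of one term for each way to distribute the degree over the three factors. -/
theorem Deg.le {d : ℕ} {S S' : Tens F} (h : Deg d S S') :
    S ≤ Tens.mul (unit F ((d + 1) * (d + 1))) S' := by
  obtain ⟨α, β, γ, e, h⟩ := h
  let u := (finProdFinEquiv (m := d + 1) (n := d + 1)).symm
  refine ⟨fun a x => (α a x.2).coeff (u x.1).1, fun b x => (β b x.2).coeff (u x.1).2,
    fun c x => if ((u x.1).1 : ℕ) + (u x.1).2 ≤ d then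
      (γ c x.2).coeff (d - (u x.1).1 - (u x.1).2) else 0, ?_⟩
  funext a b c
  have h₁ := congrArg (fun f => Polynomial.coeff f d) (h a b c)
  have h₂ : (X ^ d * (Polynomial.C (S.t a b c) + X * e a b c)).coeff d = S.t a b c := by
    rw [Polynomial.coeff_X_pow_mul', if_pos le_rfl]
    simp
  rw [h₂] at h₁
  rw [← h₁]
  have key := pull_diag_mul (ι := Fin ((d + 1) * (d + 1)))
    (fun a x => (α a x.2).coeff (u x.1).1) (fun b x => (β b x.2).coeff (u x.1).2)
    (fun c x => if ((u x.1).1 : ℕ) + (u x.1).2 ≤ d then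
      (γ c x.2).coeff (d - (u x.1).1 - (u x.1).2) else 0) S'.t a b c
  refine Eq.trans ?_ key.symm
  simp only [pull]
  rw [Polynomial.finsetSum_coeff, Finset.sum_comm]
  refine Finset.sum_congr rfl fun q _ => ?_
  rw [Polynomial.coeff_mul_C, coeff_mul_mul, Equiv.sum_comp u (fun v =>
    (α a q.1).coeff v.1 * (β b q.2.1).coeff v.2 * (if (v.1 : ℕ) + v.2 ≤ d then
      (γ c q.2.2).coeff (d - v.1 - v.2) else 0) * S'.t q.1 q.2.1 q.2.2),
    Fintype.sum_prod_type, Finset.sum_mul]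
  exact Finset.sum_congr rfl fun s _ => Finset.sum_mul _ _ _

theorem deg_unit {d r : ℕ} {S : Tens F} : Deg d S (unit F r) ↔
    ∃ (α : S.A → Fin r → F[X]) (β : S.B → Fin r → F[X]) (γ : S.C → Fin r → F[X])
      (e : S.A → S.B → S.C → F[X]), ∀ a b c,
      ∑ i, α a i * β b i * γ c i = X ^ d * (Polynomial.C (S.t a b c) + X * e a b c) := by
  have key (α : S.A → Fin r → F[X]) (β : S.B → Fin r → F[X]) (γ : S.C → Fin r → F[X]) a b c :
      pull α β γ (fun x y z => Polynomial.C ((unit F r).t x y z)) a b c =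
        ∑ i, α a i * β b i * γ c i := by
    rw [← pull_diag]
    exact congrFun₃ (congrArg (pull α β γ) (funext fun x => funext fun y => funext fun z => by
      simp [apply_ite Polynomial.C])) a b c
  exact exists_congr fun α => exists_congr fun β => exists_congr fun γ => exists_congr fun e =>
    ⟨fun h a b c => (key α β γ a b c).symm.trans (h a b c),
      fun h a b c => (key α β γ a b c).trans (h a b c)⟩

theorem deg_matMul_rotate {d m n p r : ℕ} (h : Deg d (matMul F m n p) (unit F r)) :
    Deg d (matMul F n p m) (unit F r) := by
  obtain ⟨α, β, γ, e, h⟩ := deg_unit.1 h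
  refine deg_unit.2 ⟨β, γ, α, fun b c a => e a b c, fun b c a => ?_⟩
  rw [TensClass.matMul_rotate m n p a b c, ← h a b c]
  exact Finset.sum_congr rfl fun i _ => by ring

end Tens

namespace TensClass

variable {F : Type*} [Field F]

/-- Degeneration of classes of tensors: some representatives degenerate. -/
def Deg (d : ℕ) (x y : TensClass F) : Prop := ∃ S S', mk S = x ∧ mk S' = y ∧ Tens.Deg d S S'

theorem Deg.mul {d d' : ℕ} {x x' y y' : TensClass F} (h : Deg d x y) (h' : Deg d' x' y') :
    Deg (d + d') (x * x') (y * y') := by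
  obtain ⟨S, S', rfl, rfl, h⟩ := h
  obtain ⟨T, T', rfl, rfl, h'⟩ := h'
  exact ⟨_, _, rfl, rfl, h.mul h'⟩

theorem Deg.refl (x : TensClass F) : Deg 0 x x := by
  obtain ⟨S, rfl⟩ := exists_mk x
  exact ⟨S, S, rfl, rfl, Tens.Deg.refl S⟩

theorem Deg.pow {d : ℕ} {x y : TensClass F} (h : Deg d x y) (k : ℕ) :
    Deg (d * k) (x ^ k) (y ^ k) := by
  induction k with
  | zero => simpa using Deg.refl 1
  | succ k ih => simpa only [pow_succ, mul_add, mul_one] using ih.mul h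

theorem Deg.le {d : ℕ} {x y : TensClass F} (h : Deg d x y) :
    x ≤ (((d + 1) * (d + 1) : ℕ) : TensClass F) * y := by
  obtain ⟨S, S', rfl, rfl, h⟩ := h
  exact h.le

theorem deg_mk {d : ℕ} {S S' : Tens F} : Deg d (mk S) (mk S') ↔ Tens.Deg d S S' := by
  refine ⟨?_, fun h => ⟨S, S', rfl, rfl, h⟩⟩
  rintro ⟨T, T', hT, hT', h⟩
  exact (Tens.Deg.le_trans (mk_le_mk.1 hT.ge) h).trans_le (mk_le_mk.1 hT'.le)

end TensClass

/-! ### From APA algorithms to degenerations -/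

section APA

variable {F : Type*} [Field F]

theorem linForm_single {m n : ℕ} (a : Matrix (Fin m) (Fin n) (LaurentPolynomial F))
    (i : Fin m) (j : Fin n) : linForm a (Matrix.single i j 1) = a i j := by
  classical
  simp [linForm, Matrix.single_apply, apply_ite LaurentPolynomial.C, ite_and]

theorem exists_toLaurent_eq {ι : Type*} [Finite ι] (f : ι → LaurentPolynomial F) :
    ∃ N : ℕ, ∃ g : ι → F[X], ∀ i, (g i).toLaurent = LaurentPolynomial.T N * f i := by
  classical
  have := Fintype.ofFinite ι
  choose n g hg using fun i => LaurentPolynomial.exists_T_pow (f i)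
  refine ⟨∑ i, n i, fun i => X ^ (∑ j ∈ Finset.univ.erase i, n j) * g i, fun i => ?_⟩
  rw [map_mul, hg, Polynomial.toLaurent_X_pow, ← Finset.sum_erase_add _ _ (Finset.mem_univ i),
    Nat.cast_add, LaurentPolynomial.T_add]
  ring

/-- Clearing denominators turns an identity over the Laurent polynomials into a degeneration. -/
theorem deg_unit_of_laurent {r : ℕ} (S : Tens F) (α : S.A → Fin r → LaurentPolynomial F)
    (β : S.B → Fin r → LaurentPolynomial F) (γ : S.C → Fin r → LaurentPolynomial F)
    (h : ∀ a b c, IsOLambda (∑ q, α a q * β b q * γ c q - LaurentPolynomial.C (S.t a b c))) :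
    ∃ d, Tens.Deg d S (Tens.unit F r) := by
  choose e he using h
  obtain ⟨N₁, α', hα⟩ := exists_toLaurent_eq fun x : S.A × Fin r => α x.1 x.2
  obtain ⟨N₂, β', hβ⟩ := exists_toLaurent_eq fun x : S.B × Fin r => β x.1 x.2
  obtain ⟨N₃, γ', hγ⟩ := exists_toLaurent_eq fun x : S.C × Fin r => γ x.1 x.2
  refine ⟨N₁ + N₂ + N₃, Tens.deg_unit.2 ⟨fun a q => α' (a, q), fun b q => β' (b, q),
    fun c q => γ' (c, q), e, fun a b c => Polynomial.toLaurent_injective ?_⟩⟩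
  have hsum : ∑ q, α a q * β b q * γ c q =
      LaurentPolynomial.C (S.t a b c) + Polynomial.toLaurent (X * e a b c) := by
    rw [← he]
    ring
  rw [map_sum, map_mul, map_add, Polynomial.toLaurent_C, ← hsum, Polynomial.toLaurent_X_pow,
    Finset.mul_sum]
  refine Finset.sum_congr rfl fun q _ => ?_
  rw [map_mul, map_mul, hα, hβ, hγ]
  push_cast
  rw [LaurentPolynomial.T_add, LaurentPolynomial.T_add]
  ring

theorem IsBilinearAPA.deg {m n p r : ℕ} {α : Fin r → Matrix (Fin m) (Fin n) (LaurentPolynomial F)}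
    {β : Fin r → Matrix (Fin n) (Fin p) (LaurentPolynomial F)}
    {γ : Fin r → Matrix (Fin m) (Fin p) (LaurentPolynomial F)} (h : IsBilinearAPA m n p r α β γ) :
    ∃ d, Tens.Deg d (Tens.matMul F m n p) (Tens.unit F r) := by
  refine deg_unit_of_laurent _ (fun a q => α q a.1 a.2) (fun b q => β q b.1 b.2)
    (fun c q => γ q c.2 c.1) ?_
  rintro ⟨i, j⟩ ⟨j', k⟩ ⟨k', i'⟩
  have := h (Matrix.single i j 1) (Matrix.single j' k 1) i' k'
  simp only [linForm_single] at this
  convert this using 2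
  · exact Finset.sum_congr rfl fun q _ => by ring
  · congr 1
    by_cases hj : j = j'
    · subst hj
      simp only [Matrix.single_mul_single_same, mul_one, Matrix.single_apply]
      exact if_congr (by tauto) rfl rfl
    · simp [hj, Matrix.single_mul_single_of_ne]

theorem IsTrilinearAPA.deg {m n p r : ℕ} {α : Fin r → Matrix (Fin m) (Fin n) (LaurentPolynomial F)}
    {β : Fin r → Matrix (Fin n) (Fin p) (LaurentPolynomial F)}
    {γ : Fin r → Matrix (Fin p) (Fin m) (LaurentPolynomial F)} (h : IsTrilinearAPA m n p r α β γ) :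
    ∃ d, Tens.Deg d (Tens.matMul F m n p) (Tens.unit F r) := by
  refine deg_unit_of_laurent _ (fun a q => α q a.1 a.2) (fun b q => β q b.1 b.2)
    (fun c q => γ q c.1 c.2) ?_
  rintro ⟨i, j⟩ ⟨j', k⟩ ⟨k', i'⟩
  have := h (Matrix.single i j 1) (Matrix.single j' k 1) (Matrix.single k' i' 1)
  simp only [linForm_single] at this
  convert this using 2
  congr 1
  by_cases hj : j = j'
  · subst hj
    rw [Matrix.single_mul_single_same]
    by_cases hk : k = k'
    · subst hk
      rw [Matrix.single_mul_single_same]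
      by_cases hi : i' = i
      · subst hi
        simp
      · simp [hi, Matrix.trace_single_eq_of_ne _ _ _ (Ne.symm hi)]
    · simp [hk, Matrix.single_mul_single_of_ne]
  · simp [hj, Matrix.single_mul_single_of_ne]

end APA

/-! ### An extra inner product -/

section DualFamilies

open Module

theorem exists_dotProduct_ne_zero {K A C : Type*} [Field K] [Fintype A] [Fintype C] {r : ℕ}
    (a : A → Fin r → K) (c : C → Fin r → K) (h : Fintype.card A + Fintype.card C < r) :
    ∃ x y : Fin r → K, (∀ i, x ⬝ᵥ c i = 0) ∧ (∀ i, a i ⬝ᵥ y = 0) ∧ x ⬝ᵥ y ≠ 0 := by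
  by_contra! hcon
  let L : (Fin r → K) →ₗ[K] (C → K) := LinearMap.pi fun i => dotProductEquiv K (Fin r) (c i)
  let M : (Fin r → K) →ₗ[K] (A → K) := LinearMap.pi fun i => dotProductEquiv K (Fin r) (a i)
  have hle : (LinearMap.ker L).map (dotProductEquiv K (Fin r)).toLinearMap ≤
      LinearMap.range M.dualMap := by
    rw [LinearMap.range_dualMap_eq_dualAnnihilator_ker]
    rintro _ ⟨x, hx, rfl⟩
    rw [Submodule.mem_dualAnnihilator]
    intro y hy
    refine hcon x y (fun i => ?_) fun i => congrFun (LinearMap.mem_ker.1 hy) i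
    rw [dotProduct_comm]
    exact congrFun (LinearMap.mem_ker.1 hx) i
  have h₁ := Submodule.finrank_mono hle
  rw [LinearEquiv.finrank_map_eq] at h₁
  have h₂ := LinearMap.finrank_range_le M.dualMap
  rw [Subspace.dual_finrank_eq, finrank_fintype_fun_eq_card] at h₂
  have h₃ := LinearMap.finrank_range_add_finrank_ker L
  have h₄ := Submodule.finrank_le (LinearMap.range L)
  rw [finrank_fintype_fun_eq_card] at h₃ h₄
  rw [Fintype.card_fin] at h₃
  omega

/-- In a space of dimension `r` one finds `s` pairs of dual vectors, one family orthogonal to the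
vectors `b i`, the other one orthogonal to the vectors `a i`, provided that the number of vectors
`a i` and `b i` is at most `r - s`. -/
theorem exists_dual_families {K A B : Type*} [Field K] [Fintype A] [Fintype B] {r : ℕ}
    (a : A → Fin r → K) (b : B → Fin r → K) (s : ℕ)
    (h : s + Fintype.card A + Fintype.card B ≤ r) :
    ∃ x y : Fin s → Fin r → K, (∀ i j, x i ⬝ᵥ b j = 0) ∧ (∀ i j, a j ⬝ᵥ y i = 0) ∧
      ∀ i j, x i ⬝ᵥ y j = if i = j then 1 else 0 := by
  induction s with
  | zero => exact ⟨finZeroElim, finZeroElim, finZeroElim, finZeroElim, finZeroElim⟩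
  | succ s ih =>
    obtain ⟨x, y, hx, hy, hxy⟩ := ih (by omega)
    obtain ⟨u, v, hu, hv, huv⟩ := exists_dotProduct_ne_zero a (Sum.elim b y)
      (by rw [Fintype.card_sum, Fintype.card_fin]; omega)
    -- The new vector `v` is made orthogonal to the vectors `x i` and normalized.
    let w : Fin r → K := (u ⬝ᵥ v)⁻¹ • (v - ∑ i, (x i ⬝ᵥ v) • y i)
    have huy (i) : u ⬝ᵥ y i = 0 := hu (.inr i)
    have huw : u ⬝ᵥ w = 1 := by
      simp [w, dotProduct_sub, dotProduct_sum, huy, huv]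
    have hxw (i) : x i ⬝ᵥ w = 0 := by
      simp [w, dotProduct_sub, dotProduct_sum, hxy]
    have haw (i) : a i ⬝ᵥ w = 0 := by
      simp [w, dotProduct_sub, dotProduct_sum, hy, hv]
    refine ⟨Fin.snoc x u, Fin.snoc y w, ?_, ?_, ?_⟩
    · intro i j
      cases i using Fin.lastCases with
      | last => simpa using hu (.inl j)
      | cast i => simpa using hx i j
    · intro i j
      cases i using Fin.lastCases with
      | last => simpa using haw j
      | cast i => simpa using hy i j
    · intro i j
      cases i using Fin.lastCases with
      | last =>
        cases j using Fin.lastCases with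
        | last => simpa using huw
        | cast j => simpa [(Fin.castSucc_lt_last j).ne'] using huy j
      | cast i =>
        cases j using Fin.lastCases with
        | last => simpa [(Fin.castSucc_lt_last i).ne] using hxw i
        | cast j => simpa using hxy i j

/-- The polynomial version of `exists_dual_families`: the pairing of dual vectors is now a
polynomial with lowest term `X ^ v`. -/
theorem exists_dual_families_polynomial {F A B : Type*} [Field F] [Fintype A] [Fintype B] {r : ℕ}
    (a : A → Fin r → F[X]) (b : B → Fin r → F[X]) (s : ℕ)
    (h : s + Fintype.card A + Fintype.card B ≤ r) :
    ∃ (v : ℕ) (e : F[X]) (x y : Fin s → Fin r → F[X]),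
      (∀ i j, x i ⬝ᵥ b j = 0) ∧ (∀ i j, a j ⬝ᵥ y i = 0) ∧
      ∀ i j, x i ⬝ᵥ y j = if i = j then X ^ v * (1 + X * e) else 0 := by
  let K := FractionRing F[X]
  let φ := algebraMap F[X] K
  have hφ : Function.Injective φ := IsFractionRing.injective F[X] K
  have hdot (x y : Fin r → F[X]) : φ (x ⬝ᵥ y) = (fun q => φ (x q)) ⬝ᵥ fun q => φ (y q) := by
    simp [dotProduct]
  obtain ⟨x, y, hx, hy, hxy⟩ := exists_dual_families (K := K) (fun i q => φ (a i q))
    (fun i q => φ (b i q)) s h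
  obtain ⟨g, hg⟩ := IsLocalization.exist_integer_multiples_of_finite (nonZeroDivisors F[X])
    fun p : Fin s × Fin r => x p.1 p.2
  obtain ⟨g', hg'⟩ := IsLocalization.exist_integer_multiples_of_finite (nonZeroDivisors F[X])
    fun p : Fin s × Fin r => y p.1 p.2
  choose x' hx' using hg
  choose y' hy' using hg'
  have hx' (i) : (fun q => φ (x' (i, q))) = φ g • x i := funext fun q => by
    rw [hx']; simp [φ, Algebra.smul_def]
  have hy' (i) : (fun q => φ (y' (i, q))) = φ g' • y i := funext fun q => by
    rw [hy']; simp [φ, Algebra.smul_def]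
  have hgg : (g : F[X]) * (g' : F[X]) ≠ 0 :=
    mul_ne_zero (nonZeroDivisors.ne_zero g.2) (nonZeroDivisors.ne_zero g'.2)
  obtain ⟨u, hu, hu'⟩ := Polynomial.exists_eq_pow_rootMultiplicity_mul_and_not_dvd _ hgg 0
  rw [Polynomial.C_0, sub_zero] at hu hu'
  rw [Polynomial.X_dvd_iff] at hu'
  have hC (x : Fin r → F[X]) : (fun q => Polynomial.C (u.coeff 0)⁻¹ * x q) =
      Polynomial.C (u.coeff 0)⁻¹ • x := rfl
  refine ⟨rootMultiplicity 0 ((g : F[X]) * (g' : F[X])), Polynomial.C (u.coeff 0)⁻¹ * u.divX,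
    fun i q => Polynomial.C (u.coeff 0)⁻¹ * x' (i, q), fun i q => y' (i, q), ?_, ?_, ?_⟩
  · intro i j
    apply hφ
    beta_reduce
    rw [hC, smul_dotProduct, smul_eq_mul, map_mul, hdot, hx', smul_dotProduct, hx]
    simp
  · intro i j
    apply hφ
    rw [hdot, hy', dotProduct_smul, hy]
    simp
  · intro i j
    apply hφ
    beta_reduce
    rw [hC, smul_dotProduct, smul_eq_mul, map_mul, hdot, hx', hy', smul_dotProduct,
      dotProduct_smul, hxy]
    split_ifs
    · have key : Polynomial.C (u.coeff 0)⁻¹ * ((g : F[X]) * (g' : F[X])) =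
          X ^ rootMultiplicity 0 ((g : F[X]) * (g' : F[X])) *
            (1 + X * (Polynomial.C (u.coeff 0)⁻¹ * u.divX)) := by
        have h1 : (1 : F[X]) = Polynomial.C (u.coeff 0)⁻¹ * Polynomial.C (u.coeff 0) := by
          rw [← Polynomial.C_mul, inv_mul_cancel₀ hu', Polynomial.C_1]
        have h2 := Polynomial.X_mul_divX_add u
        linear_combination Polynomial.C (u.coeff 0)⁻¹ * hu
          - X ^ rootMultiplicity 0 ((g : F[X]) * (g' : F[X])) * Polynomial.C (u.coeff 0)⁻¹ * h2
          - X ^ rootMultiplicity 0 ((g : F[X]) * (g' : F[X])) * h1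
      rw [← key]
      simp
    · simp

end DualFamilies

namespace Tens

variable {F : Type*} [Field F]

/-- The inner product of two vectors, as a tensor: `(∑ i, x i * y i) * z`. -/
abbrev dot (F : Type*) [Field F] (ι : Type) [Fintype ι] [DecidableEq ι] : Tens F where
  A := ι
  B := ι
  C := Unit
  t i j _ := if i = j then 1 else 0

theorem pull_unit_add_dot {ι A B C : Type} [Fintype ι] [DecidableEq ι] {r : ℕ}
    (α : A → Fin r ⊕ ι → F[X]) (β : B → Fin r ⊕ ι → F[X]) (γ : C → Fin r ⊕ Unit → F[X])
    (a : A) (b : B) (c : C) :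
    pull α β γ (fun x y z => Polynomial.C ((add (unit F r) (dot F ι)).t x y z)) a b c =
      ∑ q, α a (.inl q) * β b (.inl q) * γ c (.inl q) +
      ∑ i, α a (.inr i) * β b (.inr i) * γ c (.inr ()) := by
  simp [pull, Fintype.sum_prod_type, directSum, apply_ite Polynomial.C, ite_and]

open Classical in
/-- Suppose that `S = ∑ q, a_q * b_q * c_q`, up to higher order terms. Perturb the right-hand side
to `∑ q, (a_q + X ^ k * x_q) * (b_q + X ^ k * y_q) * (X ^ l * c_q + z)`, where the `x_q` are linear
forms in `s` new variables that satisfy `∑ q, x_q * b_q = 0`, and similarly for the `y_q`. The term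
of order zero is `z * ∑ q, a_q * b_q`, which an inner product of length `Fintype.card S.A` cancels,
and the term of order `2 * k` contains `z * ∑ q, x_q * y_q`, an inner product of length `s`. -/
theorem Deg.add_dot {d r s : ℕ} {S : Tens F} (h : Deg d S (unit F r))
    (hs : s + Fintype.card S.A + Fintype.card S.B ≤ r) :
    ∃ D, Deg D (add S (dot F (Fin s))) (add (unit F r) (dot F S.A)) := by
  obtain ⟨a, b, c, e, h⟩ := deg_unit.1 h
  obtain ⟨v, e', x, y, hx, hy, hxy⟩ := exists_dual_families_polynomial a b s hs
  simp only [dotProduct] at hx hy hxy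
  -- The exponents satisfy `d < k` and `l + d = 2 * k + v`.
  refine ⟨2 * (d + 1) + v,
    Sum.elim (fun i => Sum.elim (a i) fun j => if i = j then 1 else 0)
      (fun i => Sum.elim (fun q => X ^ (d + 1) * x i q) 0),
    Sum.elim (fun i => Sum.elim (b i) fun j => -∑ q, a j q * b i q)
      (fun i => Sum.elim (fun q => X ^ (d + 1) * y i q) 0),
    Sum.elim (fun i => Sum.elim (fun q => X ^ (d + 2 + v) * c i q) 0) (fun _ => 1),
    fun i j k => match i, j, k with
      | .inl i, .inl j, .inl k => e i j k
      | .inl i, .inr j, .inl k => ∑ q, a i q * y j q * c k q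
      | .inr i, .inl j, .inl k => ∑ q, x i q * b j q * c k q
      | .inr i, .inr j, .inl k => X ^ (d + 1) * ∑ q, x i q * y j q * c k q
      | .inr i, .inr j, .inr _ => if i = j then e' else 0
      | _, _, _ => 0, fun i j k => ?_⟩
  refine (pull_unit_add_dot _ _ _ i j k).trans ?_
  rcases i with i | i <;> rcases j with j | j <;> rcases k with k | k <;>
    simp only [Sum.elim_inl, Sum.elim_inr, directSum, Pi.zero_apply, Pi.one_apply, mul_zero,
      zero_mul, mul_one, Finset.sum_const_zero, add_zero, map_zero, zero_add]
  · calc ∑ q, a i q * b j q * (X ^ (d + 2 + v) * c k q)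
        = X ^ (d + 2 + v) * ∑ q, a i q * b j q * c k q := by
          rw [Finset.mul_sum]
          exact Finset.sum_congr rfl fun q _ => by ring
      _ = _ := by
          rw [h]
          ring
  · simp
  · rw [Finset.mul_sum, Finset.mul_sum]
    exact Finset.sum_congr rfl fun q _ => by ring
  · calc ∑ q, a i q * (X ^ (d + 1) * y j q) = X ^ (d + 1) * ∑ q, a i q * y j q := by
          rw [Finset.mul_sum]
          exact Finset.sum_congr rfl fun q _ => by ring
      _ = _ := by rw [hy, mul_zero]
  · rw [Finset.mul_sum, Finset.mul_sum]
    exact Finset.sum_congr rfl fun q _ => by ring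
  · calc ∑ q, X ^ (d + 1) * x i q * b j q = X ^ (d + 1) * ∑ q, x i q * b j q := by
          rw [Finset.mul_sum]
          exact Finset.sum_congr rfl fun q _ => by ring
      _ = _ := by rw [hx, mul_zero]
  · rw [Finset.mul_sum, Finset.mul_sum, Finset.mul_sum]
    exact Finset.sum_congr rfl fun q _ => by ring
  · calc ∑ q, X ^ (d + 1) * x i q * (X ^ (d + 1) * y j q)
        = X ^ (2 * (d + 1)) * ∑ q, x i q * y j q := by
          rw [Finset.mul_sum]
          exact Finset.sum_congr rfl fun q _ => by ring
      _ = _ := by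
          rw [hxy]
          split_ifs
          · rw [Polynomial.C_1]
            ring
          · simp

end Tens

namespace TensClass

variable {F : Type*} [Field F]

theorem mk_dot (ι : Type) [Fintype ι] [DecidableEq ι] :
    mk (Tens.dot F ι) = matMul F 1 (Fintype.card ι) 1 := by
  let e := Fintype.equivFin ι
  refine mk_eq_of_equivs (S := Tens.dot F ι) (S' := Tens.matMul F 1 (Fintype.card ι) 1)
    (e.trans (Equiv.uniqueProd _ (Fin 1)).symm) (e.trans (Equiv.prodUnique _ (Fin 1)).symm)
    ((Equiv.ofUnique Unit (Fin 1)).trans (Equiv.uniqueProd _ (Fin 1)).symm) ?_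
  have key (i j : ι) : (if i = j then (1 : F) else 0) =
      if e i = e j ∧ (0 : Fin 1) = 0 ∧ (0 : Fin 1) = 0 then 1 else 0 := by
    simp
  exact fun i j _ => key i j

theorem Deg.matMul_add_inner {d N r s : ℕ}
    (h : Tens.Deg d (Tens.matMul F N N N) (Tens.unit F r)) (hs : s + 2 * (N * N) ≤ r) :
    ∃ D, Deg D (matMul F N N N + matMul F 1 s 1) ((r : TensClass F) + matMul F 1 (N * N) 1) := by
  classical
  obtain ⟨D, hD⟩ := h.add_dot (s := s)
    (by simp only [Fintype.card_prod, Fintype.card_fin]; omega)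
  refine ⟨D, _, _, ?_, ?_, hD⟩
  · rw [← mk_add, mk_dot, Fintype.card_fin]
    rfl
  · rw [← mk_add, mk_dot, Fintype.card_prod, Fintype.card_fin]
    rfl

end TensClass

/-! ### A lower bound for the border rank -/

theorem mul_adjugate_mul_comm {R n : Type*} [CommRing R] [Fintype n] [DecidableEq n]
    (A B : Matrix n n R) (u v w : n → R) :
    (A * Matrix.diagonal u * B) * (A * Matrix.diagonal v * B).adjugate *
        (A * Matrix.diagonal w * B) =
      (A * Matrix.diagonal w * B) * (A * Matrix.diagonal v * B).adjugate *
        (A * Matrix.diagonal u * B) := by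
  obtain ⟨v', hv'⟩ : ∃ v', (Matrix.diagonal v).adjugate = Matrix.diagonal v' :=
    ⟨_, Matrix.adjugate_diagonal v⟩
  have key (u w : n → R) :
      (A * Matrix.diagonal u * B) * (A * Matrix.diagonal v * B).adjugate *
        (A * Matrix.diagonal w * B) =
        (B.det * A.det) • (A * Matrix.diagonal (fun i => u i * v' i * w i) * B) := by
    rw [Matrix.adjugate_mul_distrib, Matrix.adjugate_mul_distrib, hv']
    calc _ = A * Matrix.diagonal u * (B * B.adjugate) * Matrix.diagonal v' * (A.adjugate * A)
          * Matrix.diagonal w * B := by simp only [Matrix.mul_assoc]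
      _ = _ := by
        rw [Matrix.mul_adjugate, Matrix.adjugate_mul]
        simp only [Matrix.mul_smul, Matrix.smul_mul, Matrix.mul_one, Matrix.mul_assoc, smul_smul]
        simp only [← Matrix.mul_assoc, Matrix.diagonal_mul_diagonal]
        simp only [mul_comm B.det, mul_assoc]
  rw [key, key]
  simp only [mul_comm, mul_left_comm]

/-- The border rank of the multiplication of `V × V` matrices is larger than `V ^ 2`. Otherwise the
matrices of the bilinear forms `(A, B) ↦ trace (A * B * W)`, which are Kronecker products of `W`
with an identity matrix, are limits of matrices `A * D * B` with diagonal `D` and square `A`, `B`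
that do not depend on `W`; as the identity matrix is among them, they commute. -/
theorem Tens.Deg.lt_of_matMul {F : Type*} [Field F] {d V r : ℕ} (hV : 2 ≤ V)
    (h : Deg d (matMul F V V V) (unit F r)) : V * V < r := by
  by_contra! hr
  obtain ⟨α, β, γ, e, h⟩ := deg_unit.1
    (h.trans_le (TensClass.mk_le_mk.1 (Nat.mono_cast (α := TensClass F) hr)))
  let A : Matrix (Fin V × Fin V) (Fin V × Fin V) F[X] := .of fun a q => α a (finProdFinEquiv q)
  let B : Matrix (Fin V × Fin V) (Fin V × Fin V) F[X] := .of fun q b =>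
    β (b.2, b.1) (finProdFinEquiv q)
  let g (c : Fin V × Fin V) : Fin V × Fin V → F[X] := fun q => γ c (finProdFinEquiv q)
  let N (c : Fin V × Fin V) : Matrix (Fin V × Fin V) (Fin V × Fin V) F[X] := .of fun a b =>
    Polynomial.C ((matMul F V V V).t a (b.2, b.1) c) + X * e a (b.2, b.1) c
  have hN (c : Fin V × Fin V) : A * Matrix.diagonal (g c) * B = (X ^ d : F[X]) • N c := by
    ext1 a b
    rw [Matrix.smul_apply, smul_eq_mul]
    refine Eq.trans ?_ (h a (b.2, b.1) c)
    rw [← Equiv.sum_comp finProdFinEquiv]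
    rw [Matrix.mul_apply]
    refine Finset.sum_congr rfl fun q _ => ?_
    rw [Matrix.mul_diagonal]
    simp only [A, B, g, Matrix.of_apply]
    ring
  have hN₁ : A * Matrix.diagonal (∑ i, g (i, i)) * B = (X ^ d : F[X]) • ∑ i, N (i, i) := by
    rw [Finset.smul_sum]
    simp only [← hN]
    rw [← Finset.sum_mul, ← Finset.mul_sum]
    congr 2
    ext1 a b
    simp [Matrix.sum_apply, Matrix.diagonal_apply]
  have hcomm (c c' : Fin V × Fin V) : N c * (∑ i, N (i, i)).adjugate * N c' =
      N c' * (∑ i, N (i, i)).adjugate * N c := by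
    have := mul_adjugate_mul_comm A B (g c) (∑ i, g (i, i)) (g c')
    rw [hN, hN, hN₁, Matrix.adjugate_smul] at this
    simp only [Matrix.smul_mul, Matrix.mul_smul, smul_smul] at this
    exact smul_right_injective _ (by simp [Polynomial.X_ne_zero]) this
  let ev := Polynomial.evalRingHom (0 : F)
  let m (c : Fin V × Fin V) : Matrix (Fin V × Fin V) (Fin V × Fin V) F := .of fun a b =>
    (matMul F V V V).t a (b.2, b.1) c
  have hm (c : Fin V × Fin V) : ev.mapMatrix (N c) = m c := by
    ext1 a b
    simp [ev, N, m, apply_ite (Polynomial.eval (0 : F))]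
  have hm₁ : ∑ i, m (i, i) = 1 := by
    ext1 ⟨i, j⟩ ⟨k, l⟩
    rw [Matrix.sum_apply, Matrix.one_apply, Finset.sum_eq_single k]
    · exact if_congr ⟨fun h => Prod.ext h.2.2.symm h.1, fun h => ⟨congrArg Prod.snd h, rfl,
        (congrArg Prod.fst h).symm⟩⟩ rfl rfl
    · intro x _ hx
      exact if_neg fun h => hx h.2.1.symm
    · simp
  have hcomm' (c c' : Fin V × Fin V) : m c * m c' = m c' * m c := by
    have := congrArg ev.mapMatrix (hcomm c c')
    rw [map_mul, map_mul, map_mul, map_mul, RingHom.map_adjugate, map_sum] at this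
    simpa only [hm, hm₁, Matrix.adjugate_one, mul_one] using this
  have hmm (i j : Fin V) (hij : i ≠ j) : False := by
    have := congrFun₂ (hcomm' (i, j) (j, i)) (i, i) (i, i)
    rw [Matrix.mul_apply, Matrix.mul_apply, Finset.sum_eq_zero, Finset.sum_eq_single (j, i)]
      at this
    · simp [m] at this
    · rintro ⟨k, l⟩ _ hkl
      simp only [m, Matrix.of_apply]
      by_cases hk : k = j
      · subst hk
        rw [if_neg (fun h => hkl (by rw [h.1])), zero_mul]
      · rw [if_neg (fun h => hk h.2.1), zero_mul]
    · simp
    · intro x _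
      simp [m, hij.symm]
  exact hmm ⟨0, by omega⟩ ⟨1, by omega⟩ (by simp)

/-! ### Asymptotic rank -/

open Filter Topology

theorem exists_forall_le_mul_pow (d : ℕ) {ρ : ℝ} (hρ : 1 < ρ) :
    ∃ K : ℝ, ∀ M : ℕ, (((d * M + 1) * (d * M + 1) : ℕ) : ℝ) ≤ K * ρ ^ M := by
  have hρ0 : 0 < ρ := by linarith
  obtain ⟨B, hB⟩ := (tendsto_pow_const_div_const_pow_of_one_lt 2 hρ).bddAbove_range
  refine ⟨(d + 1) ^ 2 * (B * ρ), fun M => ?_⟩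
  have h := hB ⟨M + 1, rfl⟩
  simp only [div_le_iff₀ (pow_pos hρ0 (M + 1))] at h
  have h' : (d * M + 1 : ℝ) ≤ (d + 1) * (M + 1) := by
    have : (0 : ℝ) ≤ d := d.cast_nonneg
    have : (0 : ℝ) ≤ M := M.cast_nonneg
    nlinarith
  push_cast at h ⊢
  calc (d * M + 1 : ℝ) * (d * M + 1) ≤ ((d + 1) * (M + 1)) * ((d + 1) * (M + 1)) := by gcongr
    _ = (d + 1) ^ 2 * (M + 1) ^ 2 := by ring
    _ ≤ (d + 1) ^ 2 * (B * ρ ^ (M + 1)) := by gcongr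
    _ = _ := by ring

theorem le_of_forall_pow_le {u c K : ℝ} (hc : 0 ≤ c)
    (h : ∀ M : ℕ, 1 ≤ M → u ^ M ≤ K * (M + 1) * c ^ M) : u ≤ c := by
  by_contra! hlt
  rcases hc.eq_or_lt with rfl | hc
  · have := h 1 le_rfl
    simp only [pow_one, mul_zero] at this
    linarith
  have hρ : 1 < u / c := (one_lt_div hc).2 hlt
  have hlim := (tendsto_pow_const_div_const_pow_of_one_lt 1 hρ).const_mul (|K| * 2)
  rw [mul_zero] at hlim
  obtain ⟨M, hM, hM1⟩ := ((hlim.eventually_lt_const one_pos).and (eventually_ge_atTop 1)).exists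
  have hM1' : (1 : ℝ) ≤ M := by exact_mod_cast hM1
  have h1 := h M hM1
  have hpos : 0 < (u / c) ^ M := by positivity
  rw [pow_one, mul_div_assoc', div_lt_one hpos, div_pow, lt_div_iff₀ (pow_pos hc M)] at hM
  have h2 : K * (M + 1) * c ^ M ≤ |K| * 2 * M * c ^ M := by
    have hK := le_abs_self K
    have hK' := abs_nonneg K
    refine mul_le_mul_of_nonneg_right ?_ (by positivity)
    nlinarith
  linarith

theorem le_of_forall_pos_le_of_continuous {a : ℝ} {f : ℝ → ℝ} (hf : Continuous f)
    (h : ∀ ε > 0, a ≤ f ε) : a ≤ f 0 :=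
  ge_of_tendsto ((hf.tendsto 0).mono_left nhdsWithin_le_nhds : Tendsto f (𝓝[>] 0) (𝓝 (f 0)))
    (eventually_nhdsWithin_of_forall fun ε hε => h ε hε)

namespace TensClass

variable {F : Type*} [Field F]

/-- The rank of the powers `x ^ j` is bounded by a multiple of `c ^ j`. -/
def IsRankBound (x : TensClass F) (c : ℝ) : Prop :=
  0 ≤ c ∧ ∃ C : ℝ, ∀ j : ℕ, ∃ n : ℕ, x ^ j ≤ (n : TensClass F) ∧ (n : ℝ) ≤ C * c ^ j

/-- The asymptotic rank: the growth rate of the rank of the powers of `x`. -/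
noncomputable def asympRank (x : TensClass F) : ℝ := sInf {c | IsRankBound x c}

theorem mul_le_mul_of_le {x x' y y' : TensClass F} (h : x ≤ x') (h' : y ≤ y') : x * y ≤ x' * y' :=
  mul_le_mul h h' (TensClass.zero_le _) (TensClass.zero_le _)

theorem isRankBound_of_le {x : TensClass F} {n : ℕ} (h : x ≤ n) : IsRankBound x n :=
  ⟨n.cast_nonneg, 1, fun j => ⟨n ^ j, by
    rw [Nat.cast_pow]; exact pow_le_pow_left₀ (TensClass.zero_le _) h j, by simp⟩⟩

theorem exists_isRankBound (x : TensClass F) : ∃ c, IsRankBound x c :=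
  let ⟨n, hn⟩ := exists_le_natCast x
  ⟨n, isRankBound_of_le hn⟩

theorem IsRankBound.const_nonneg {x : TensClass F} {c : ℝ} (h : IsRankBound x c) :
    0 ≤ c ∧ ∃ C : ℝ, 0 ≤ C ∧ ∀ j : ℕ, ∃ n : ℕ, x ^ j ≤ (n : TensClass F) ∧ (n : ℝ) ≤ C * c ^ j := by
  obtain ⟨hc, C, hC⟩ := h
  obtain ⟨n, -, hn⟩ := hC 0
  refine ⟨hc, C, ?_, hC⟩
  rw [pow_zero, mul_one] at hn
  exact n.cast_nonneg.trans hn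

theorem IsRankBound.mono {x : TensClass F} {c c' : ℝ} (h : IsRankBound x c) (hcc : c ≤ c') :
    IsRankBound x c' := by
  obtain ⟨hc, C, hC0, hC⟩ := h.const_nonneg
  refine ⟨hc.trans hcc, C, fun j => ?_⟩
  obtain ⟨n, hn, hn'⟩ := hC j
  exact ⟨n, hn, hn'.trans (by gcongr)⟩

theorem IsRankBound.mul {x y : TensClass F} {c c' : ℝ} (h : IsRankBound x c)
    (h' : IsRankBound y c') : IsRankBound (x * y) (c * c') := by
  obtain ⟨hc, C, hC0, hC⟩ := h.const_nonneg
  obtain ⟨hc', C', hC0', hC'⟩ := h'.const_nonneg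
  refine ⟨mul_nonneg hc hc', C * C', fun j => ?_⟩
  obtain ⟨n, hn, hn'⟩ := hC j
  obtain ⟨m, hm, hm'⟩ := hC' j
  refine ⟨n * m, ?_, ?_⟩
  · rw [mul_pow, Nat.cast_mul]
    exact mul_le_mul_of_le hn hm
  · rw [Nat.cast_mul, mul_pow]
    calc (n : ℝ) * m ≤ (C * c ^ j) * (C' * c' ^ j) := by gcongr
      _ = _ := by ring

theorem IsRankBound.add {x y : TensClass F} {c c' : ℝ} (h : IsRankBound x c)
    (h' : IsRankBound y c') : IsRankBound (x + y) (c + c') := by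
  obtain ⟨hc, C, hC0, hC⟩ := h.const_nonneg
  obtain ⟨hc', C', hC0', hC'⟩ := h'.const_nonneg
  choose n hn hn' using hC
  choose m hm hm' using hC'
  refine ⟨add_nonneg hc hc', C * C', fun j =>
    ⟨∑ i ∈ Finset.range (j + 1), n i * m (j - i) * j.choose i, ?_, ?_⟩⟩
  · rw [add_pow, Nat.cast_sum]
    refine Finset.sum_le_sum fun i _ => ?_
    rw [Nat.cast_mul, Nat.cast_mul]
    exact mul_le_mul_of_le (mul_le_mul_of_le (hn _) (hm _)) le_rfl
  · rw [add_pow, Nat.cast_sum, Finset.mul_sum]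
    refine Finset.sum_le_sum fun i _ => ?_
    rw [Nat.cast_mul, Nat.cast_mul]
    calc (n i : ℝ) * m (j - i) * j.choose i
        ≤ (C * c ^ i) * (C' * c' ^ (j - i)) * j.choose i := by gcongr <;> apply_assumption
      _ = _ := by ring

theorem asympRank_le {x : TensClass F} {c : ℝ} (h : IsRankBound x c) : asympRank x ≤ c :=
  csInf_le ⟨0, fun _ h => h.1⟩ h

theorem le_asympRank {x : TensClass F} {u : ℝ} (h : ∀ c, IsRankBound x c → u ≤ c) :
    u ≤ asympRank x := le_csInf (exists_isRankBound x) h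

theorem asympRank_nonneg (x : TensClass F) : 0 ≤ asympRank x := le_asympRank fun _ h => h.1

theorem isRankBound_of_asympRank_lt {x : TensClass F} {c : ℝ} (h : asympRank x < c) :
    IsRankBound x c :=
  let ⟨_, hc', hlt⟩ := exists_lt_of_csInf_lt (exists_isRankBound x) h
  IsRankBound.mono hc' hlt.le

theorem asympRank_natCast_le (n : ℕ) : asympRank (n : TensClass F) ≤ n :=
  asympRank_le (isRankBound_of_le le_rfl)

theorem asympRank_mul_le (x y : TensClass F) :
    asympRank (x * y) ≤ asympRank x * asympRank y := by
  simpa using le_of_forall_pos_le_of_continuous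
    (f := fun ε => (asympRank x + ε) * (asympRank y + ε))
    (by fun_prop) fun ε hε => asympRank_le ((isRankBound_of_asympRank_lt (by linarith)).mul
      (isRankBound_of_asympRank_lt (by linarith)))

theorem asympRank_add_le (x y : TensClass F) :
    asympRank (x + y) ≤ asympRank x + asympRank y := by
  simpa using le_of_forall_pos_le_of_continuous
    (f := fun ε => (asympRank x + ε) + (asympRank y + ε))
    (by fun_prop) fun ε hε => asympRank_le ((isRankBound_of_asympRank_lt (by linarith)).add
      (isRankBound_of_asympRank_lt (by linarith)))

theorem asympRank_pow_le (x : TensClass F) (k : ℕ) : asympRank (x ^ k) ≤ asympRank x ^ k := by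
  induction k with
  | zero => simpa using asympRank_natCast_le (F := F) 1
  | succ k ih =>
    rw [pow_succ, pow_succ]
    exact (asympRank_mul_le _ _).trans (mul_le_mul_of_nonneg_right ih (asympRank_nonneg x))

theorem IsRankBound.of_pow {x : TensClass F} {k : ℕ} (hk : 0 < k) {e : ℝ} (he : 0 < e)
    (h : IsRankBound (x ^ k) (e ^ k)) : IsRankBound x e := by
  obtain ⟨-, C, hC0, hC⟩ := h.const_nonneg
  choose R hR using fun i : ℕ => exists_le_natCast (x ^ i)
  refine ⟨he.le, C * ∑ i ∈ Finset.range k, R i / e ^ i, fun j => ?_⟩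
  obtain ⟨n, hn, hn'⟩ := hC (j / k)
  refine ⟨n * R (j % k), ?_, ?_⟩
  · conv_lhs => rw [← Nat.div_add_mod j k, pow_add, pow_mul]
    rw [Nat.cast_mul]
    exact mul_le_mul_of_le hn (hR _)
  · have h₁ : (R (j % k) : ℝ) / e ^ (j % k) ≤ ∑ i ∈ Finset.range k, R i / e ^ i :=
      Finset.single_le_sum (f := fun i => (R i : ℝ) / e ^ i) (fun i _ => by positivity)
        (Finset.mem_range.2 (Nat.mod_lt j hk))
    have h₂ : e ^ j = (e ^ k) ^ (j / k) * e ^ (j % k) := by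
      rw [← pow_mul, ← pow_add, Nat.div_add_mod]
    have h₃ : (R (j % k) : ℝ) = R (j % k) / e ^ (j % k) * e ^ (j % k) := by
      field_simp
    rw [Nat.cast_mul, h₂, h₃]
    calc (n : ℝ) * (R (j % k) / e ^ (j % k) * e ^ (j % k))
        ≤ (C * (e ^ k) ^ (j / k)) *
          ((∑ i ∈ Finset.range k, R i / e ^ i) * e ^ (j % k)) := by gcongr
      _ = _ := by ring

theorem pow_asympRank_le (x : TensClass F) {k : ℕ} (hk : 0 < k) :
    asympRank x ^ k ≤ asympRank (x ^ k) := by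
  refine le_asympRank fun c hc => le_of_forall_pos_le_add fun ε hε => ?_
  have hpos : 0 < c + ε := by linarith [hc.1]
  have he : ((c + ε) ^ (1 / k : ℝ)) ^ k = c + ε := by
    rw [← Real.rpow_natCast, ← Real.rpow_mul hpos.le, one_div, inv_mul_cancel₀ (by positivity),
      Real.rpow_one]
  rw [← he]
  refine pow_le_pow_left₀ (asympRank_nonneg x) (asympRank_le (.of_pow hk (by positivity) ?_)) k
  rw [he]
  exact hc.mono (by linarith)

/-- The asymptotic rank is monotone under degeneration: passing from a degeneration to a restriction
costs only a polynomial factor. -/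
theorem Deg.asympRank_le {d : ℕ} {x y : TensClass F} (h : Deg d x y) :
    asympRank x ≤ asympRank y := by
  have key : ∀ ε > 0, asympRank x ≤ (asympRank y + ε) * (1 + ε) := by
    intro ε hε
    obtain ⟨hc, C, hC0, hC⟩ := (isRankBound_of_asympRank_lt (x := y)
      (c := asympRank y + ε) (by linarith)).const_nonneg
    obtain ⟨K, hK⟩ := exists_forall_le_mul_pow d (ρ := 1 + ε) (by linarith)
    refine TensClass.asympRank_le ⟨by positivity, C * K, fun j => ?_⟩
    obtain ⟨n, hn, hn'⟩ := hC j
    refine ⟨(d * j + 1) * (d * j + 1) * n, (h.pow j).le.trans ?_, ?_⟩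
    · rw [Nat.cast_mul _ n]
      exact mul_le_mul_of_le le_rfl hn
    · rw [Nat.cast_mul _ n, mul_pow]
      calc _ ≤ (K * (1 + ε) ^ j) * (C * (asympRank y + ε) ^ j) :=
            mul_le_mul (hK j) hn' n.cast_nonneg ((Nat.cast_nonneg _).trans (hK j))
        _ = _ := by ring
  simpa using le_of_forall_pos_le_of_continuous
    (f := fun ε => (asympRank y + ε) * (1 + ε)) (by fun_prop) key

/-- Schönhage's argument: if `n` products suffice for `q` disjoint copies of `x`, then the
asymptotic rank of `x` is about `n / q`, since each of these products can again be taken to be a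
copy of `x`. -/
theorem asympRank_le_of_copies {x : TensClass F} {q n : ℕ} (hq : 0 < q)
    (h : (q : TensClass F) * x ≤ (n : TensClass F)) : asympRank x ≤ n / q + 1 := by
  have hq' : (0 : ℝ) < q := by exact_mod_cast hq
  set m := ⌈(n / q : ℝ)⌉₊ with hm
  have hnm : n ≤ m * q := by
    have := Nat.le_ceil (n / q : ℝ)
    rw [div_le_iff₀ hq'] at this
    exact_mod_cast this
  have hnm' : (n : TensClass F) ≤ (m : TensClass F) * q := by
    rw [← Nat.cast_mul]
    exact Nat.mono_cast hnm
  have key (i : ℕ) : (q : TensClass F) * x ^ i ≤ (m : TensClass F) ^ i * q := by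
    induction i with
    | zero => simp
    | succ i ih =>
      calc (q : TensClass F) * x ^ (i + 1) = q * x ^ i * x := by ring
        _ ≤ m ^ i * q * x := mul_le_mul_of_le ih le_rfl
        _ = m ^ i * (q * x) := by ring
        _ ≤ m ^ i * (m * q) := mul_le_mul_of_le le_rfl (h.trans hnm')
        _ = _ := by ring
  have hb : IsRankBound x m := by
    refine ⟨m.cast_nonneg, q, fun j => ⟨m ^ j * q, ?_, by push_cast; rw [mul_comm]⟩⟩
    rw [Nat.cast_mul, Nat.cast_pow]
    refine le_trans ?_ (key j)
    conv_lhs => rw [← one_mul (x ^ j)]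
    exact mul_le_mul_of_le (by exact_mod_cast Nat.mono_cast (α := TensClass F) hq) le_rfl
  exact (asympRank_le hb).trans (Nat.ceil_lt_add_one (by positivity)).le

/-- A lower bound for the asymptotic rank of a sum: `(x + y) ^ M` contains `M.choose k` copies of
`x ^ k * y ^ (M - k)`. -/
theorem add_le_asympRank_add {x y : TensClass F} {α β : ℝ} (hα : 2 ≤ α) (hβ : 2 ≤ β)
    (h : ∀ i j : ℕ, 1 ≤ i + j → α ^ i * β ^ j ≤ asympRank (x ^ i * y ^ j)) :
    α + β ≤ asympRank (x + y) := by
  refine le_asympRank fun c hc => ?_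
  obtain ⟨hc, C, hC0, hC⟩ := hc.const_nonneg
  refine le_of_forall_pow_le (K := 2 * C) hc fun M hM => ?_
  obtain ⟨n, hn, hn'⟩ := hC M
  have key : ∀ k ∈ Finset.range (M + 1), α ^ k * β ^ (M - k) * M.choose k ≤ 2 * n := by
    intro k hk
    have hkM : k ≤ M := Nat.lt_succ_iff.1 (Finset.mem_range.1 hk)
    have hq : 0 < M.choose k := Nat.choose_pos hkM
    have h₁ : ((M.choose k : ℕ) : TensClass F) * (x ^ k * y ^ (M - k)) ≤ (n : TensClass F) := by
      refine le_trans ?_ hn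
      rw [add_pow, mul_comm]
      exact Finset.single_le_sum (f := fun k => x ^ k * y ^ (M - k) * (M.choose k : TensClass F))
        (fun i _ => TensClass.zero_le _) hk
    have h₂ := (h k (M - k) (by omega)).trans (asympRank_le_of_copies hq h₁)
    have h₃ : 2 ≤ α ^ k * β ^ (M - k) := by
      calc (2 : ℝ) = 2 ^ 1 := by norm_num
        _ ≤ 2 ^ M := pow_le_pow_right₀ (by norm_num) hM
        _ = 2 ^ k * 2 ^ (M - k) := by rw [← pow_add]; congr 1; omega
        _ ≤ _ := by gcongr
    have hq' : (0 : ℝ) < M.choose k := by exact_mod_cast hq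
    have h₄ : α ^ k * β ^ (M - k) / 2 ≤ n / M.choose k := by linarith
    rw [le_div_iff₀ hq'] at h₄
    linarith
  calc (α + β) ^ M ≤ ∑ k ∈ Finset.range (M + 1), (2 * n : ℝ) := by
        rw [add_pow]
        exact Finset.sum_le_sum key
    _ = 2 * (M + 1) * n := by simp; ring
    _ ≤ 2 * (M + 1) * (C * c ^ M) := by gcongr
    _ = _ := by ring

theorem asympRank_matMul_rotate_le (m n p : ℕ) :
    asympRank (matMul F n p m) ≤ asympRank (matMul F m n p) := by
  refine le_asympRank fun c hc => asympRank_le ⟨hc.1, ?_⟩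
  obtain ⟨C, hC⟩ := hc.2
  refine ⟨C, fun j => ?_⟩
  obtain ⟨k, hk, hk'⟩ := hC j
  rw [matMul_pow] at hk
  exact ⟨k, by rw [matMul_pow]; exact matMul_rotate_le hk, hk'⟩

end TensClass

/-! ### The border rank does not attain the exponent -/

namespace TensClass

variable {F : Type*} [Field F]

/-- If `r` bounds the border rank of `T = ⟨V, V, V⟩` and `T ^ h ⊕ ⟨1, V ^ a, 1⟩` is a degeneration
of `r ^ h ⊕ ⟨1, V ^ b, 1⟩` with `b < a`, then `r` exceeds the asymptotic rank of `T`. Otherwise the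
asymptotic rank of `T ^ g * ⟨1, V, 1⟩` is at least `r ^ g * y`, where `y` is the infimum of these
ratios, and `y > 1` because `T` is the product of the three rotations of `⟨1, V, 1⟩`. Multiplication
of the degeneration by `T ^ (g * b)` and comparison of asymptotic ranks gives `y ^ a ≤ y ^ b`. -/
theorem exists_pow_le_natCast_lt {V r h a b d D : ℕ} (hr : 2 ≤ r) (hh : 1 ≤ h) (hb : 1 ≤ b)
    (hba : b < a) (hT : Deg d (matMul F V V V) (r : TensClass F))
    (hD : Deg D (matMul F V V V ^ h + matMul F 1 V 1 ^ a)
      ((r : TensClass F) ^ h + matMul F 1 V 1 ^ b)) :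
    ∃ j n : ℕ, 1 ≤ j ∧ matMul F V V V ^ j ≤ (n : TensClass F) ∧ n < r ^ j := by
  by_contra! hcon
  set T := matMul F V V V with hTdef
  set E := matMul F 1 V 1 with hEdef
  have hr0 : (0 : ℝ) < r := by exact_mod_cast (by omega : 0 < r)
  have hr2 : (2 : ℝ) ≤ r := by exact_mod_cast hr
  have hr1 : (1 : ℝ) ≤ r := by linarith
  have hTr : asympRank T = r := by
    refine le_antisymm (hT.asympRank_le.trans (asympRank_natCast_le r))
      (le_asympRank fun c hc => ?_)
    obtain ⟨hc, C, hC0, hC⟩ := hc.const_nonneg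
    refine le_of_forall_pow_le (K := C) hc fun j hj => ?_
    obtain ⟨n, hn, hn'⟩ := hC j
    have h₁ : ((r ^ j : ℕ) : ℝ) ≤ n := by exact_mod_cast hcon j n hj hn
    push_cast at h₁
    refine h₁.trans (hn'.trans (mul_le_mul_of_nonneg_right ?_ (by positivity)))
    have : (0 : ℝ) ≤ j := j.cast_nonneg
    nlinarith
  have hTpow (j : ℕ) (hj : 1 ≤ j) : (r : ℝ) ^ j ≤ asympRank (T ^ j) :=
    hTr ▸ pow_asympRank_le T hj
  have hTpow' (j : ℕ) : asympRank (T ^ j) ≤ (r : ℝ) ^ j := hTr ▸ asympRank_pow_le T j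
  -- The ratios for `g = 0` are left out: below, `g * b` has to be positive.
  let y (g : ℕ) : ℝ := asympRank (T ^ (g + 1) * E) / r ^ (g + 1)
  have hy (g : ℕ) : asympRank (T ^ (g + 1) * E) = r ^ (g + 1) * y g := by
    simp only [y]
    field_simp
  have hy_nonneg (g : ℕ) : 0 ≤ y g := div_nonneg (asympRank_nonneg _) (by positivity)
  have hy_bdd : BddBelow (Set.range y) := ⟨0, by rintro _ ⟨g, rfl⟩; exact hy_nonneg g⟩
  have hy_cube (g : ℕ) : (r : ℝ) ≤ y g ^ 3 := by
    have hfmt : T ^ (g + 1) * E =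
        matMul F (V ^ (g + 1)) (V ^ (g + 2)) (V ^ (g + 1)) := by
      rw [hTdef, hEdef, matMul_pow, matMul_mul, mul_one, ← pow_succ]
    have hprod : T ^ (3 * (g + 1) + 1) =
        matMul F (V ^ (g + 1)) (V ^ (g + 2)) (V ^ (g + 1)) *
        matMul F (V ^ (g + 2)) (V ^ (g + 1)) (V ^ (g + 1)) *
        matMul F (V ^ (g + 1)) (V ^ (g + 1)) (V ^ (g + 2)) := by
      rw [hTdef, matMul_pow, matMul_mul, matMul_mul]
      congr 1 <;> ring
    have h₁ := asympRank_matMul_rotate_le (F := F) (V ^ (g + 1)) (V ^ (g + 2)) (V ^ (g + 1))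
    have h₂ := asympRank_matMul_rotate_le (F := F) (V ^ (g + 2)) (V ^ (g + 1)) (V ^ (g + 1))
    set φ := asympRank (matMul F (V ^ (g + 1)) (V ^ (g + 2)) (V ^ (g + 1))) with hφ
    have hφ0 : 0 ≤ φ := asympRank_nonneg _
    have h₃ : (r : ℝ) ^ (3 * (g + 1) + 1) ≤ φ ^ 3 := by
      refine (hTpow _ (by omega)).trans ?_
      rw [hprod]
      refine (asympRank_mul_le _ _).trans ?_
      calc _ ≤ (φ * φ) * φ := by
            refine mul_le_mul ((asympRank_mul_le _ _).trans ?_) (h₂.trans h₁) (asympRank_nonneg _)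
              (by positivity)
            exact mul_le_mul le_rfl h₁ (asympRank_nonneg _) hφ0
        _ = φ ^ 3 := by ring
    simp only [y]
    rw [hfmt, div_pow, le_div_iff₀ (by positivity)]
    calc (r : ℝ) * (r ^ (g + 1)) ^ 3 = r ^ (3 * (g + 1) + 1) := by ring
      _ ≤ _ := h₃
  let y₀ := ⨅ g, y g
  have hy₀ (g : ℕ) : y₀ ≤ y g := ciInf_le hy_bdd g
  have hy₀_nonneg : 0 ≤ y₀ := le_ciInf hy_nonneg
  have hy₀_gt : 1 < y₀ := by
    have hlt : (1 : ℝ) < (r : ℝ) ^ (1 / 3 : ℝ) :=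
      Real.one_lt_rpow (by linarith) (by norm_num)
    refine hlt.trans_le (le_ciInf fun g => ?_)
    refine le_of_pow_le_pow_left₀ (n := 3) (by norm_num) (hy_nonneg g) ?_
    rw [← Real.rpow_natCast, ← Real.rpow_mul hr0.le]
    norm_num
    exact hy_cube g
  have hlow (j l : ℕ) (hj : 1 ≤ j) : (r : ℝ) ^ j * y₀ ^ l ≤ asympRank (T ^ j * E ^ l) := by
    rcases Nat.eq_zero_or_pos l with rfl | hl
    · simpa using hTpow j hj
    obtain ⟨i, rfl⟩ : ∃ i, j = i + 1 := ⟨j - 1, by omega⟩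
    obtain ⟨k, rfl⟩ : ∃ k, l = k + 1 := ⟨l - 1, by omega⟩
    have h₁ : asympRank (T ^ (i + 1) * E) ^ (k + 1) ≤
        r ^ ((i + 1) * k) * asympRank (T ^ (i + 1) * E ^ (k + 1)) := by
      refine (pow_asympRank_le _ hl).trans ?_
      have : (T ^ (i + 1) * E) ^ (k + 1) =
          T ^ ((i + 1) * k) * (T ^ (i + 1) * E ^ (k + 1)) := by ring
      rw [this]
      exact (asympRank_mul_le _ _).trans
        (mul_le_mul_of_nonneg_right (hTpow' _) (asympRank_nonneg _))
    rw [hy] at h₁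
    have h₂ : (r : ℝ) ^ ((i + 1) * k) * (r ^ (i + 1) * y₀ ^ (k + 1)) ≤
        r ^ ((i + 1) * k) * asympRank (T ^ (i + 1) * E ^ (k + 1)) := by
      refine le_trans ?_ h₁
      calc (r : ℝ) ^ ((i + 1) * k) * (r ^ (i + 1) * y₀ ^ (k + 1))
          = (r ^ (i + 1) * y₀) ^ (k + 1) := by ring
        _ ≤ _ := by gcongr; exact hy₀ i
    exact le_of_mul_le_mul_left h₂ (by positivity)
  have hmain (g : ℕ) : y₀ ^ a ≤ y g ^ b := by
    have hG1 : 1 ≤ (g + 1) * b := Nat.mul_pos (Nat.succ_pos g) hb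
    set G := (g + 1) * b with hG
    have hrG : (2 : ℝ) ≤ r ^ G := by
      calc (2 : ℝ) ≤ r ^ 1 := by simpa using hr2
        _ ≤ r ^ G := pow_le_pow_right₀ hr1 hG1
    have hya : 1 ≤ y₀ ^ a := one_le_pow₀ hy₀_gt.le
    have hup : asympRank ((T ^ h + E ^ a) * T ^ G) ≤ r ^ h * r ^ G + (r ^ (g + 1) * y g) ^ b := by
      refine (hD.mul (Deg.refl (T ^ G))).asympRank_le.trans ?_
      have h₁ : ((r : TensClass F) ^ h + E ^ b) * T ^ G =
          ((r ^ h : ℕ) : TensClass F) * T ^ G + (T ^ (g + 1) * E) ^ b := by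
        rw [hG]
        push_cast
        ring
      rw [h₁, ← hy]
      refine (asympRank_add_le _ _).trans (add_le_add ((asympRank_mul_le _ _).trans ?_)
        (asympRank_pow_le _ _))
      refine mul_le_mul ?_ (hTpow' G) (asympRank_nonneg _) (by positivity)
      exact_mod_cast asympRank_natCast_le (F := F) (r ^ h)
    have hdown : (r : ℝ) ^ (h + G) + r ^ G * y₀ ^ a ≤ asympRank ((T ^ h + E ^ a) * T ^ G) := by
      have h₁ : (T ^ h + E ^ a) * T ^ G = T ^ (h + G) + T ^ G * E ^ a := by ring
      rw [h₁]
      refine add_le_asympRank_add ?_ (by nlinarith) fun i j hij => ?_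
      · rw [pow_add]
        have : (1 : ℝ) ≤ r ^ h := one_le_pow₀ hr1
        nlinarith
      · have h₂ : (T ^ (h + G)) ^ i * (T ^ G * E ^ a) ^ j =
            T ^ ((h + G) * i + G * j) * E ^ (a * j) := by ring
        rw [h₂]
        refine le_trans (le_of_eq (by ring)) (hlow ((h + G) * i + G * j) (a * j) ?_)
        have h₃ : i ≤ (h + G) * i := Nat.le_mul_of_pos_left i (by omega)
        have h₄ : j ≤ G * j := Nat.le_mul_of_pos_left j (by omega)
        omega
    have h₅ := hdown.trans hup
    have h₆ : ((r : ℝ) ^ (g + 1) * y g) ^ b = r ^ G * y g ^ b := by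
      rw [mul_pow, ← pow_mul]
    rw [h₆, pow_add] at h₅
    exact le_of_mul_le_mul_left (by linarith) (by positivity : (0 : ℝ) < r ^ G)
  -- Since `y₀ ^ b < y₀ ^ a`, some ratio `y g` is so close to `y₀` that `y g ^ b < y₀ ^ a`.
  let z : ℝ := (y₀ ^ a) ^ (1 / b : ℝ)
  have hz : z ^ b = y₀ ^ a := by
    simp only [z]
    rw [← Real.rpow_natCast, ← Real.rpow_mul (by positivity), one_div,
      inv_mul_cancel₀ (by exact_mod_cast (by omega : b ≠ 0)), Real.rpow_one]
  have hy₀z : y₀ < z := by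
    refine lt_of_pow_lt_pow_left₀ b (by positivity) ?_
    rw [hz]
    exact pow_lt_pow_right₀ hy₀_gt hba
  obtain ⟨g, hg⟩ := exists_lt_of_ciInf_lt hy₀z
  have := pow_lt_pow_left₀ hg (hy_nonneg g) (by omega : b ≠ 0)
  rw [hz] at this
  exact absurd (hmain g) (not_le.2 this)

/-- The product of the three rotations of `⟨m, n, p⟩` is the multiplication of square matrices of
size `m * n * p`. -/
theorem deg_matMul_cube {d m n p r : ℕ} (h : Tens.Deg d (Tens.matMul F m n p) (Tens.unit F r)) :
    Deg (d + d + d) (matMul F (m * n * p) (m * n * p) (m * n * p)) ((r ^ 3 : ℕ) : TensClass F) := by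
  have h' := Tens.deg_matMul_rotate h
  have h'' := Tens.deg_matMul_rotate h'
  have key := (Deg.mul (F := F) ⟨_, _, rfl, rfl, h⟩ ⟨_, _, rfl, rfl, h'⟩).mul
    ⟨_, _, rfl, rfl, h''⟩
  change Deg (d + d + d) (matMul F m n p * matMul F n p m * matMul F p m n)
    ((r : TensClass F) * r * r) at key
  rw [matMul_mul, matMul_mul] at key
  convert key using 2
  · ring
  · ring
  · push_cast
    ring

/-- A bound for the border rank of a matrix multiplication is never optimal: some power of the
symmetrized product has an exact algorithm with fewer multiplications than that power of the
bound. -/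
theorem exists_matMul_le_natCast_lt {d m n p r : ℕ} (hmnp : 1 < m * n * p)
    (h : Tens.Deg d (Tens.matMul F m n p) (Tens.unit F r)) :
    ∃ j N : ℕ, 1 ≤ j ∧ matMul F ((m * n * p) ^ j) ((m * n * p) ^ j) ((m * n * p) ^ j) ≤
      (N : TensClass F) ∧ N < (r ^ 3) ^ j := by
  have hT := deg_matMul_cube h
  set V := m * n * p
  have hlt : V * V < r ^ 3 := (deg_mk.1 hT).lt_of_matMul hmnp
  have bernoulli (x k : ℕ) : x ^ k * (x + k) ≤ x * (x + 1) ^ k := by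
    induction k with
    | zero => simp
    | succ k ih =>
      calc x ^ (k + 1) * (x + (k + 1)) ≤ x ^ (k + 1) * (x + (k + 1)) + x ^ k * k :=
            Nat.le_add_right _ _
        _ = x ^ k * (x + k) * (x + 1) := by ring
        _ ≤ x * (x + 1) ^ k * (x + 1) := Nat.mul_le_mul_right _ ih
        _ = _ := by ring
  -- This exponent is so large that `V ^ (2 * h + 1) + 2 * V ^ (2 * h) ≤ (r ^ 3) ^ h`.
  set h₀ := V * V * (V + 1)
  have hV : 0 < V * V := by positivity
  have hs : V ^ (2 * h₀ + 1) + 2 * (V ^ h₀ * V ^ h₀) ≤ (r ^ 3) ^ h₀ := by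
    have h₁ := bernoulli (V * V) h₀
    have h₂ : (V * V) ^ h₀ * (V * V + h₀) =
        (V * V) * (V ^ (2 * h₀ + 1) + 2 * (V ^ h₀ * V ^ h₀)) := by
      have : V * V + h₀ = V * V * (V + 2) := by simp only [h₀]; ring
      rw [this]
      ring
    rw [h₂] at h₁
    exact (Nat.le_of_mul_le_mul_left h₁ hV).trans (Nat.pow_le_pow_left hlt h₀)
  have hpow := hT.pow h₀
  rw [matMul_pow, ← Nat.cast_pow] at hpow
  obtain ⟨D, hD⟩ := Deg.matMul_add_inner (deg_mk.1 hpow) hs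
  have hE (k : ℕ) : matMul F 1 V 1 ^ k = matMul F 1 (V ^ k) 1 := by
    rw [matMul_pow, one_pow]
  obtain ⟨j, N, hj, hN, hN'⟩ := exists_pow_le_natCast_lt (F := F) (V := V) (r := r ^ 3) (h := h₀)
    (a := 2 * h₀ + 1) (b := 2 * h₀) (by nlinarith) (Nat.mul_pos hV (by omega))
    (Nat.mul_pos two_pos (Nat.mul_pos hV (by omega))) (by omega) hT (D := D) (by
      rw [hE, hE, matMul_pow, ← Nat.cast_pow]
      convert hD using 3
      rw [two_mul, pow_add])
  exact ⟨j, N, hj, by rwa [matMul_pow] at hN, hN'⟩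

end TensClass

/-! ### Straight-line computations -/

section Reach

variable (F : Type*) {P : Type*} [Field F] [CommRing P] [Algebra F P]

/-- Starting from the elements of `S` and the constants, `n` arithmetic operations can be chosen
such that the elements known afterwards are those of the last argument. -/
inductive Reach (S : Set P) : ℕ → Set P → Prop
  | start : Reach S 0 (S ∪ Set.range (algebraMap F P))
  | step {n : ℕ} {S' : Set P} {a b : P} (op : ArithOp) (h : Reach S n S') (ha : a ∈ S')
      (hb : b ∈ S') : Reach S (n + 1) (insert (op.eval a b) S')

/-- All elements of `T` can be computed from those of `S` with at most `n` arithmetic operations. -/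
def Computes (S T : Set P) (n : ℕ) : Prop := ∃ k ≤ n, ∃ S', Reach F S k S' ∧ T ⊆ S'

variable {F}

theorem Reach.subset {S S' : Set P} {n : ℕ} (h : Reach F S n S') :
    S ∪ Set.range (algebraMap F P) ⊆ S' := by
  induction h with
  | start => exact subset_rfl
  | step op _ _ _ ih => exact ih.trans (Set.subset_insert _ _)

theorem Reach.append {S S' T T' : Set P} {n m : ℕ} (h : Reach F S n S') (h' : Reach F T m T')
    (hT : T ⊆ S') : ∃ S'', Reach F S (n + m) S'' ∧ S' ⊆ S'' ∧ T' ⊆ S'' := by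
  induction h' with
  | start => exact ⟨S', h, subset_rfl,
      Set.union_subset hT (Set.subset_union_right.trans h.subset)⟩
  | step op _ ha hb ih =>
    obtain ⟨S'', hS'', h₁, h₂⟩ := ih
    exact ⟨_, hS''.step op (h₂ ha) (h₂ hb), h₁.trans (Set.subset_insert _ _),
      Set.insert_subset_insert h₂⟩

namespace Computes

theorem of_subset {S T : Set P} (h : T ⊆ S ∪ Set.range (algebraMap F P)) : Computes F S T 0 :=
  ⟨0, le_rfl, _, .start, h⟩

theorem trans {S T U : Set P} {n m : ℕ} (h : Computes F S T n) (h' : Computes F (S ∪ T) U m) :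
    Computes F S (T ∪ U) (n + m) := by
  obtain ⟨k, hk, S', hS', hT⟩ := h
  obtain ⟨l, hl, T', hT', hU⟩ := h'
  obtain ⟨S'', hS'', h₁, h₂⟩ := hS'.append hT'
    (Set.union_subset (Set.subset_union_left.trans hS'.subset) hT)
  exact ⟨k + l, add_le_add hk hl, S'', hS'', Set.union_subset (hT.trans h₁) (hU.trans h₂)⟩

theorem mono {S S' T T' : Set P} {n n' : ℕ} (h : Computes F S T n) (hS : S ⊆ S') (hT : T' ⊆ T)
    (hn : n ≤ n') : Computes F S' T' n' := by
  obtain ⟨k, hk, U, hU, hTU⟩ := h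
  obtain ⟨S'', hS'', -, h₂⟩ := (Reach.start (F := F) (S := S')).append hU
    (hS.trans Set.subset_union_left)
  exact ⟨0 + k, by omega, S'', hS'', hT.trans (hTU.trans h₂)⟩

theorem of_union_constants {S T : Set P} {n : ℕ}
    (h : Computes F (S ∪ Set.range (algebraMap F P)) T n) : Computes F S T n :=
  ((of_subset Set.subset_union_right).trans h).mono subset_rfl Set.subset_union_right (by omega)

theorem union {S T U : Set P} {n m : ℕ} (h : Computes F S T n) (h' : Computes F S U m) :
    Computes F S (T ∪ U) (n + m) :=
  h.trans (h'.mono Set.subset_union_left subset_rfl le_rfl)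

theorem iUnion {ι : Type*} [Fintype ι] {S : Set P} {T : ι → Set P} {n : ℕ}
    (h : ∀ i, Computes F S (T i) n) : Computes F S (⋃ i, T i) (Fintype.card ι * n) := by
  classical
  have key (s : Finset ι) : Computes F S (⋃ i ∈ s, T i) (s.card * n) := by
    induction s using Finset.induction_on with
    | empty => exact (of_subset (by simp)).mono subset_rfl subset_rfl (Nat.zero_le _)
    | insert i s hi ih =>
      refine ((h i).union ih).mono subset_rfl (by simp) ?_
      rw [Finset.card_insert_of_notMem hi]
      exact le_of_eq (by ring)
  exact (key Finset.univ).mono subset_rfl (by simp) le_rfl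

theorem op {S : Set P} {a b : P} (o : ArithOp) (ha : a ∈ S ∪ Set.range (algebraMap F P))
    (hb : b ∈ S ∪ Set.range (algebraMap F P)) : Computes F S {o.eval a b} 1 :=
  ⟨1, le_rfl, _, Reach.start.step o ha hb, by simp⟩

theorem linearCombination {ι : Type*} (s : Finset ι) {S : Set P} (c : ι → F) {v : ι → P}
    (hv : ∀ i, v i ∈ S) : Computes F S {∑ i ∈ s, c i • v i} (2 * s.card) := by
  classical
  induction s using Finset.induction_on with
  | empty => exact of_subset (by simpa using Or.inr ⟨0, map_zero _⟩)
  | insert i s hi ih =>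
    have h₁ : Computes F S {c i • v i} 1 := by
      rw [Algebra.smul_def]
      exact op .mul (.inr ⟨_, rfl⟩) (.inl (hv i))
    have h₂ := (ih.union h₁).trans (op (F := F) (a := c i • v i) (b := ∑ i ∈ s, c i • v i) .add
      (by simp) (by simp))
    rw [Finset.sum_insert hi, Finset.card_insert_of_notMem hi]
    exact h₂.mono subset_rfl Set.subset_union_right (by omega)

theorem linearCombinations {ι κ : Type*} [Fintype ι] [Fintype κ] {S : Set P} (c : κ → ι → F)
    {v : κ → ι → P} (hv : ∀ k i, v k i ∈ S) :
    Computes F S (Set.range fun k => ∑ i, c k i • v k i)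
      (Fintype.card κ * (2 * Fintype.card ι)) := by
  refine (iUnion fun k => linearCombination Finset.univ (c k) (hv k)).mono subset_rfl ?_ le_rfl
  rintro _ ⟨k, rfl⟩
  exact Set.mem_iUnion.2 ⟨k, rfl⟩

end Computes

/-! ### Recursive matrix multiplication -/

variable (F P) in
/-- Matrices with rows and columns indexed by `ι` and entries in `P` can be multiplied with at most
`n` arithmetic operations. -/
def ComputesMul (ι : Type*) [Fintype ι] (n : ℕ) : Prop :=
  ∀ (S : Set P) (U V : Matrix ι ι P), (∀ i j, U i j ∈ S) → (∀ i j, V i j ∈ S) →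
    Computes F S (Set.range fun p : ι × ι => (U * V) p.1 p.2) n

namespace ComputesMul

theorem of_equiv {ι κ : Type*} [Fintype ι] [Fintype κ] (e : ι ≃ κ) {n : ℕ}
    (h : ComputesMul F P ι n) : ComputesMul F P κ n := by
  intro S U V hU hV
  refine (h S (U.submatrix e e) (V.submatrix e e) (fun i j => hU _ _) fun i j => hV _ _).mono
    subset_rfl ?_ le_rfl
  rintro _ ⟨⟨i, j⟩, rfl⟩
  refine ⟨(e.symm i, e.symm j), ?_⟩
  simp [Matrix.submatrix_mul_equiv]

theorem of_sum {ι κ : Type*} [Fintype ι] [Fintype κ] {n : ℕ}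
    (h : ComputesMul F P (ι ⊕ κ) n) : ComputesMul F P ι n := by
  intro S U V hU hV
  have h0 : (0 : P) ∈ S ∪ Set.range (algebraMap F P) := .inr ⟨0, map_zero _⟩
  have hmem (U : Matrix ι ι P) (hU : ∀ i j, U i j ∈ S) (i j : ι ⊕ κ) :
      Matrix.fromBlocks U 0 0 0 i j ∈ S ∪ Set.range (algebraMap F P) := by
    rcases i with i | i <;> rcases j with j | j
    · exact .inl (hU i j)
    all_goals exact h0
  refine (h _ (.fromBlocks U 0 0 0) (.fromBlocks V 0 0 0) (hmem U hU)
    (hmem V hV)).of_union_constants.mono subset_rfl ?_ le_rfl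
  rintro _ ⟨⟨i, j⟩, rfl⟩
  exact ⟨(.inl i, .inl j), by simp [Matrix.fromBlocks_multiply]⟩

theorem mono_fin {K L n : ℕ} (hKL : K ≤ L) (h : ComputesMul F P (Fin L) n) :
    ComputesMul F P (Fin K) n := by
  obtain ⟨d, rfl⟩ := Nat.exists_eq_add_of_le hKL
  exact (h.of_equiv finSumFinEquiv.symm).of_sum

theorem of_unique (ι : Type*) [Fintype ι] [Unique ι] : ComputesMul F P ι 1 := by
  intro S U V hU hV
  refine (Computes.op (F := F) (a := U default default) (b := V default default) .mul
    (.inl (hU _ _)) (.inl (hV _ _))).mono subset_rfl ?_ le_rfl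
  rintro _ ⟨⟨i, j⟩, rfl⟩
  rw [Unique.eq_default i, Unique.eq_default j, Set.mem_singleton_iff]
  simp [Matrix.mul_apply, ArithOp.eval]

/-- One step of the recursion: an exact algorithm for `M × M` matrices with `R` multiplications is
applied to matrices of blocks. -/
theorem prod {M R : ℕ} (hR : TensClass.matMul F M M M ≤ (R : TensClass F))
    {ι : Type*} [Fintype ι] {n : ℕ} (h : ComputesMul F P ι n) :
    ComputesMul F P (Fin M × ι) (R * n + 6 * R * M ^ 2 * Fintype.card ι ^ 2) := by
  obtain ⟨α, β, γ, hR⟩ := TensClass.mk_le_natCast.1 hR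
  change Fin M × Fin M → Fin R → F at α β γ
  intro S U V hU hV
  let L (q : Fin R) : Matrix ι ι P :=
    .of fun x y => ∑ p : Fin M × Fin M, α p q • U (p.1, x) (p.2, y)
  let L' (q : Fin R) : Matrix ι ι P :=
    .of fun x y => ∑ p : Fin M × Fin M, β p q • V (p.1, x) (p.2, y)
  have hmul (i : Fin M) (x : ι) (k : Fin M) (y : ι) :
      (U * V) (i, x) (k, y) = ∑ q, γ (k, i) q • (L q * L' q) x y := by
    have hcoeff (p p' : Fin M × Fin M) : ∑ q, γ (k, i) q * (α p q * β p' q) =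
        if p.2 = p'.1 ∧ p'.2 = k ∧ i = p.1 then 1 else 0 := by
      refine Eq.trans ?_ (hR p p' (k, i)).symm
      exact Finset.sum_congr rfl fun q _ => by ring
    calc (U * V) (i, x) (k, y)
        = ∑ z, ∑ p : Fin M × Fin M, ∑ p' : Fin M × Fin M,
            (if p.2 = p'.1 ∧ p'.2 = k ∧ i = p.1 then (1 : F) else 0) •
              (U (p.1, x) (p.2, z) * V (p'.1, z) (p'.2, y)) := by
          rw [Matrix.mul_apply, Fintype.sum_prod_type_right]
          refine Finset.sum_congr rfl fun z _ => ?_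
          simp [Fintype.sum_prod_type, ite_and, Finset.sum_ite_irrel]
      _ = ∑ z, ∑ p : Fin M × Fin M, ∑ p' : Fin M × Fin M, ∑ q, γ (k, i) q •
            ((α p q • U (p.1, x) (p.2, z)) * (β p' q • V (p'.1, z) (p'.2, y))) := by
          refine Finset.sum_congr rfl fun z _ => Finset.sum_congr rfl fun p _ =>
            Finset.sum_congr rfl fun p' _ => ?_
          rw [← hcoeff, Finset.sum_smul]
          exact Finset.sum_congr rfl fun q _ => by rw [smul_mul_smul_comm, smul_smul]
      _ = _ := by
          simp only [L, L', Matrix.mul_apply, Matrix.of_apply, Finset.sum_mul_sum, Finset.smul_sum]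
          symm
          rw [Finset.sum_comm]
          refine Finset.sum_congr rfl fun z _ => ?_
          rw [Finset.sum_comm]
          refine Finset.sum_congr rfl fun p _ => ?_
          rw [Finset.sum_comm]
  have h₁ : Computes F S (Set.range fun p : Fin R × ι × ι => L p.1 p.2.1 p.2.2)
      (R * Fintype.card ι ^ 2 * (2 * M ^ 2)) :=
    (Computes.linearCombinations (fun (p : Fin R × ι × ι) (p' : Fin M × Fin M) => α p' p.1)
      (v := fun p p' => U (p'.1, p.2.1) (p'.2, p.2.2)) fun _ _ => hU _ _).mono subset_rfl subset_rfl
      (by simp [sq])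
  have h₂ : Computes F S (Set.range fun p : Fin R × ι × ι => L' p.1 p.2.1 p.2.2)
      (R * Fintype.card ι ^ 2 * (2 * M ^ 2)) :=
    (Computes.linearCombinations (fun (p : Fin R × ι × ι) (p' : Fin M × Fin M) => β p' p.1)
      (v := fun p p' => V (p'.1, p.2.1) (p'.2, p.2.2)) fun _ _ => hV _ _).mono subset_rfl subset_rfl
      (by simp [sq])
  have h₃ := (h₁.union h₂).trans (Computes.iUnion fun q : Fin R => h _ (L q) (L' q)
    (fun i j => .inr (.inl ⟨(q, i, j), rfl⟩)) fun i j => .inr (.inr ⟨(q, i, j), rfl⟩))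
  refine (h₃.trans (Computes.linearCombinations
    (fun (p : (Fin M × ι) × (Fin M × ι)) (q : Fin R) => γ (p.2.1, p.1.1) q)
    (v := fun p q => (L q * L' q) p.1.2 p.2.2) fun p q =>
      .inr (.inr (Set.mem_iUnion.2 ⟨q, (p.1.2, p.2.2), rfl⟩)))).mono subset_rfl ?_ ?_
  · rintro _ ⟨⟨⟨i, x⟩, k, y⟩, rfl⟩
    exact .inr ⟨((i, x), k, y), (hmul i x k y).symm⟩
  · simp only [Fintype.card_prod, Fintype.card_fin]
    exact le_of_eq (by ring)

end ComputesMul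

end Reach

/-! ### From computations to programs -/

theorem run_append {F ι A : Type*} [Field F] [CommRing A] [Algebra F A] (x : ι → A)
    (c c' : List (Instr F ι)) (mem : List A) : run x (c ++ c') mem = run x c' (run x c mem) := by
  induction c generalizing mem with
  | nil => rfl
  | cons I c ih => exact ih _

theorem length_run {F ι A : Type*} [Field F] [CommRing A] [Algebra F A] (x : ι → A)
    (c : List (Instr F ι)) (mem : List A) : (run x c mem).length = mem.length + c.length := by
  induction c generalizing mem with
  | nil => rfl
  | cons I c ih =>
    rw [run, ih]
    simp
    omega

/-- A computation with polynomials, starting from the variables, yields a program: each known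
polynomial is the value of an operand, also when the memory is extended by further results `l`. -/
theorem Reach.exists_code.{u} {F : Type u} {ι : Type} [Field F] {n : ℕ}
    {S' : Set (MvPolynomial ι F)} (h : Reach F (Set.range MvPolynomial.X) n S') :
    ∃ code : List (Instr F ι), code.length = n ∧ ∀ p ∈ S', ∃ o : Operand F ι,
      ∀ (A : Type u) [CommRing A] [Algebra F A] (x : ι → A) (l : List A),
        o.eval x (run x code [] ++ l) = MvPolynomial.aeval x p := by
  induction h with
  | start =>
    refine ⟨[], rfl, ?_⟩
    rintro _ (⟨i, rfl⟩ | ⟨a, rfl⟩)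
    · exact ⟨.input i, fun A _ _ x l => by simp [Operand.eval]⟩
    · exact ⟨.const a, fun A _ _ x l => by simp [Operand.eval]⟩
  | @step n S' a b op _ ha hb ih =>
    obtain ⟨code, hlen, hcode⟩ := ih
    obtain ⟨oa, hoa⟩ := hcode a ha
    obtain ⟨ob, hob⟩ := hcode b hb
    have hrun (A : Type u) [CommRing A] [Algebra F A] (x : ι → A) :
        run x (code ++ [⟨op, oa, ob⟩]) [] =
          run x code [] ++ [MvPolynomial.aeval x (op.eval a b)] := by
      have ha' := hoa A x []
      have hb' := hob A x []
      rw [List.append_nil] at ha' hb'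
      rw [run_append]
      simp only [run, ha', hb']
      cases op <;> simp [ArithOp.eval]
    refine ⟨code ++ [⟨op, oa, ob⟩], by simp [hlen], ?_⟩
    rintro p (rfl | hp)
    · refine ⟨.result n, fun A _ _ x l => ?_⟩
      have hlen' : (run x code []).length = n := by rw [length_run, hlen]; simp
      rw [hrun, Operand.eval, List.append_assoc, List.getD_append_right _ _ _ _ hlen'.le, hlen']
      simp
    · obtain ⟨o, ho⟩ := hcode p hp
      exact ⟨o, fun A _ _ x l => by rw [hrun, List.append_assoc]; exact ho A x _⟩

theorem ComputesMul.exists_program.{u} {F : Type u} [Field F] {K n : ℕ}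
    (h : ComputesMul F (MvPolynomial ((Fin K × Fin K) ⊕ (Fin K × Fin K)) F) (Fin K) n) :
    ∃ P : Program F ((Fin K × Fin K) ⊕ (Fin K × Fin K)) (Fin K × Fin K),
      PerformsMM K P ∧ P.cost ≤ n := by
  obtain ⟨k, hk, S', hS', hT⟩ := h (Set.range MvPolynomial.X)
    (.of fun i j => MvPolynomial.X (.inl (i, j))) (.of fun i j => MvPolynomial.X (.inr (i, j)))
    (fun i j => ⟨_, rfl⟩) fun i j => ⟨_, rfl⟩
  obtain ⟨code, hlen, hcode⟩ := hS'.exists_code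
  choose o ho using fun p : Fin K × Fin K => hcode _ (hT ⟨p, rfl⟩)
  refine ⟨⟨code, o⟩, fun A _ _ U V i k => ?_, hlen.trans_le hk⟩
  have := ho (i, k) A (Sum.elim (fun a => U a.1 a.2) fun b => V b.1 b.2) []
  rw [List.append_nil] at this
  refine this.trans ?_
  simp [Matrix.mul_apply]

/-- An exact algorithm for `M × M` matrices with `R < M ^ ω` multiplications gives `O(K ^ ω)`
arithmetic operations for `K × K` matrices, provided that `M ^ 2 ≤ M ^ ω`. -/
theorem exists_computesMul_le.{u, v} {F : Type u} [Field F] {M R : ℕ} {ω : ℝ}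
    (hM : 2 ≤ M) (hR : TensClass.matMul F M M M ≤ (R : TensClass F)) (hRω : (R : ℝ) < (M : ℝ) ^ ω)
    (hω : 0 ≤ ω) (hMω : (M : ℝ) ^ 2 ≤ (M : ℝ) ^ ω) :
    ∃ c : ℝ, 0 ≤ c ∧ ∀ K : ℕ, 1 ≤ K → ∃ n : ℕ,
      (∀ (P : Type v) [CommRing P] [Algebra F P], ComputesMul F P (Fin K) n) ∧
      (n : ℝ) ≤ c * (K : ℝ) ^ ω := by
  have hM0 : (0 : ℝ) < M := by exact_mod_cast (by omega : 0 < M)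
  set s : ℝ := (M : ℝ) ^ ω with hs
  have hs0 : 0 < s := Real.rpow_pos_of_pos hM0 ω
  have hsR : 0 < s - R := by linarith
  -- The constant satisfies `R * C + 6 * R * M ^ 2 ≤ C * s`.
  set C : ℝ := 1 + 6 * R * M ^ 2 / (s - R) with hC
  have hC1 : 1 ≤ C := by
    have : 0 ≤ 6 * R * M ^ 2 / (s - R) := by positivity
    linarith
  have hCs : R * C + 6 * R * M ^ 2 ≤ C * s := by
    have : 6 * R * M ^ 2 = (C - 1) * (s - R) := by
      rw [hC]
      field_simp
      ring
    nlinarith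
  have hpow (k : ℕ) : ∃ n : ℕ,
      (∀ (P : Type v) [CommRing P] [Algebra F P], ComputesMul F P (Fin (M ^ k)) n) ∧
      (n : ℝ) ≤ C * s ^ k := by
    induction k with
    | zero =>
      exact ⟨1, fun _ _ _ => (ComputesMul.of_unique (Fin 1)).of_equiv (finCongr (pow_zero M).symm),
        by simpa using hC1⟩
    | succ k ih =>
      obtain ⟨n, hn, hn'⟩ := ih
      refine ⟨R * n + 6 * R * M ^ 2 * (M ^ k) ^ 2, fun P _ _ => ?_, ?_⟩
      · have := ((hn P).prod hR).of_equiv (finProdFinEquiv.trans (finCongr (pow_succ' M k).symm))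
        rwa [Fintype.card_fin] at this
      push_cast
      have h₁ : ((M : ℝ) ^ k) ^ 2 ≤ s ^ k := by
        rw [← pow_mul, mul_comm, pow_mul]
        gcongr
      calc (R : ℝ) * n + 6 * R * M ^ 2 * (M ^ k) ^ 2
          ≤ R * (C * s ^ k) + 6 * R * M ^ 2 * s ^ k := by gcongr
        _ = (R * C + 6 * R * M ^ 2) * s ^ k := by ring
        _ ≤ C * s * s ^ k := by gcongr
        _ = _ := by ring
  refine ⟨C * s, by positivity, fun K hK => ?_⟩
  have hK0 : (0 : ℝ) < K := by exact_mod_cast hK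
  obtain ⟨n, hn, hn'⟩ := hpow (Nat.clog M K)
  refine ⟨n, fun P _ _ => (hn P).mono_fin (Nat.le_pow_clog hM K), hn'.trans ?_⟩
  have hclog : M ^ Nat.clog M K ≤ M * K := by
    rcases Nat.eq_zero_or_pos (Nat.clog M K) with h0 | h0
    · rw [h0, pow_zero]
      exact Nat.mul_pos (by omega) hK
    · obtain ⟨k, hk⟩ : ∃ k, Nat.clog M K = k + 1 := ⟨_, (Nat.succ_pred_eq_of_pos h0).symm⟩
      have h₂ : ¬ K ≤ M ^ k := fun h => by
        have := Nat.clog_le_of_le_pow h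
        omega
      rw [hk, pow_succ']
      exact Nat.mul_le_mul_left _ (by omega)
  have hclog' : (M : ℝ) ^ Nat.clog M K ≤ M * K := by exact_mod_cast hclog
  calc C * s ^ Nat.clog M K = C * ((M : ℝ) ^ Nat.clog M K) ^ ω := by
        rw [hs, ← Real.rpow_natCast, ← Real.rpow_natCast, ← Real.rpow_mul hM0.le,
          ← Real.rpow_mul hM0.le, mul_comm ω]
    _ ≤ C * (M * K) ^ ω := by gcongr
    _ = C * s * K ^ ω := by rw [Real.mul_rpow hM0.le hK0.le, hs]; ring

end FastMM

theorem theorem6p1 {F : Type*} [Field F] (m n p r : ℕ) (hmnp : 1 < m * n * p)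
    (hAPA : (∃ α β γ, FastMM.IsBilinearAPA (F := F) m n p r α β γ) ∨
      (∃ α β γ, FastMM.IsTrilinearAPA (F := F) m n p r α β γ)) :
    ∃ c : ℝ, ∀ K : ℕ,
      ∃ P : FastMM.Program F ((Fin K × Fin K) ⊕ (Fin K × Fin K)) (Fin K × Fin K),
        FastMM.PerformsMM K P ∧
        (P.cost : ℝ) ≤ c * (K : ℝ) ^ (3 * Real.logb ((m * n * p : ℕ) : ℝ) (r : ℝ)) := by
  obtain ⟨d, hd⟩ : ∃ d, FastMM.Tens.Deg d (FastMM.Tens.matMul F m n p) (FastMM.Tens.unit F r) := by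
    rcases hAPA with ⟨α, β, γ, h⟩ | ⟨α, β, γ, h⟩
    · exact h.deg
    · exact h.deg
  obtain ⟨j, N, hj, hN, hNr⟩ := FastMM.TensClass.exists_matMul_le_natCast_lt hmnp hd
  have hlt := (FastMM.TensClass.deg_mk.1 (FastMM.TensClass.deg_matMul_cube hd)).lt_of_matMul hmnp
  set V := m * n * p with hV
  set ω := 3 * Real.logb (V : ℝ) (r : ℝ) with hω
  have hV1 : (1 : ℝ) < V := by exact_mod_cast hmnp
  have hV0 : (0 : ℝ) < V := by linarith
  have hr : 0 < r := Nat.pos_of_ne_zero fun h => by simp [h] at hlt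
  have hr1 : (1 : ℝ) ≤ r := by exact_mod_cast hr
  have hω0 : 0 ≤ ω := mul_nonneg (by norm_num) (Real.logb_nonneg hV1 hr1)
  have hVω : (V : ℝ) ^ ω = (r : ℝ) ^ 3 := by
    rw [hω, mul_comm, Real.rpow_mul hV0.le, Real.rpow_logb hV0 hV1.ne' (by linarith)]
    exact_mod_cast Real.rpow_natCast (r : ℝ) 3
  have hMω : ((V ^ j : ℕ) : ℝ) ^ ω = ((r : ℝ) ^ 3) ^ j := by
    rw [Nat.cast_pow, ← Real.rpow_natCast, ← Real.rpow_mul hV0.le, mul_comm, Real.rpow_mul hV0.le,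
      hVω, Real.rpow_natCast]
  obtain ⟨c, hc0, hc⟩ := FastMM.exists_computesMul_le (F := F) (M := V ^ j) (R := N) (ω := ω)
    (hmnp.trans_le (Nat.le_self_pow (by omega) V)) hN
    (by rw [hMω]; exact_mod_cast hNr) hω0 (by
      rw [hMω, Nat.cast_pow, ← pow_mul, mul_comm, pow_mul]
      refine pow_le_pow_left₀ (by positivity) ?_ j
      rw [sq]
      exact_mod_cast hlt.le)
  refine ⟨c, fun K => ?_⟩
  rcases Nat.eq_zero_or_pos K with rfl | hK
  · refine ⟨⟨[], fun k => k.1.elim0⟩, fun _ _ _ _ _ i => i.elim0, ?_⟩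
    simpa [FastMM.Program.cost] using mul_nonneg hc0 (Real.rpow_nonneg le_rfl _)
  · obtain ⟨n, hn, hnc⟩ := hc K hK
    obtain ⟨P, hP, hPn⟩ :=
      (hn (MvPolynomial ((Fin K × Fin K) ⊕ (Fin K × Fin K)) F)).exists_program
    exact ⟨P, hP, (Nat.cast_le.2 hPn).trans hnc⟩
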